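/- Let $M$ be a finite-dimensional (Hausdorff, second countable) smooth manifold with a smooth left action of a finite-dimensional Lie group $G$ with Lie algebra $\mathfrak g$. Lift the action to $T^*M$ by $g\cdot(u,v)=(gu,\,v\circ (d(g^{-1}\cdot))_{gu})$; for $a\in\mathfrak g$ let $k_a$, $K_a$ be the vector fields on $M$, $T^*M$ generated by $a$. Let $\lambda_{(u,v)}(X)=v(d\,\mathrm{pr}_M X)$ be the Liouville form, $\omega=d\lambda$, let the Hamiltonian field $K_F$ of a function $F$ be defined by $i_{K_F}\omega=-dF$, and let $\{F_1,F_2\}=\omega(K_{F_1},K_{F_2})$ be the canonical Poisson bracket (so $\{v_j,u^i\}=\delta_j^i$ in canonical coordinates). Let $l:T^*M\to\mathfrak g^*$, $\langle l(u,v),a\rangle=v(k_a(u))$, be the momentum map, let $\xi\in\mathfrak g^*$ be a regular value of $l$, $\mathcal M_\xi=l^{-1}(\xi)$, and let $G_\xi=\{g: \mathrm{Ad}^*_{g^{-1}}\xi=\xi\}$ be the coadjoint isotropy group of $\xi$. Assume that $G_\xi$ acts freely and properly on $\mathcal M_\xi$, and let $r_\xi:\mathcal M_\xi\to\bar{\mathcal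 M}_\xi=\mathcal M_\xi/G_\xi$ be the projection. The reduced symplectic form $\bar\omega_\xi$ on $\bar{\mathcal M}_\xi$ is defined by $r_\xi^*\bar\omega_\xi=\omega|_{\mathcal M_\xi}$ (on the tangent spaces $T_{r_\xi(x)}\bar{\mathcal M}_\xi=T_x\mathcal M_\xi/T_x(G_\xi x)$), and the reduced Poisson bracket of functions $f_1,f_2$ on $\bar{\mathcal M}_\xi$ is $\{f_1,f_2\}^r_\xi=\bar\omega_\xi(\bar K_{f_1},\bar K_{f_2})$ with $i_{\bar K_f}\bar\omega_\xi=-df$. Then $\omega$ is non-degenerate (so that every $K_F$ exists and is unique), and for all smooth $f_1,f_2:\bar{\mathcal M}_\xi\to\mathbb R$ (i.e. smooth $G_\xi$-invariant functions on $\mathcal M_\xi$): 1. the reduced Poisson bracket $\{f_1,f_2\}^r_\xi:\bar{\mathcal M}_\xi\to\mathbb R$ exists (in particular $\bar\omega_\xi$ exists and is non-degenerate) and is unique; 2. $f_1\circ r_\xi$ and $f_2\circ r_\xi$ have smooth extensions to an open neighbourhood of $\mathcal M_\xi$ in $T^*M$; 3. let $U$ be any open neighbourhood of $\mathcal M_\xi$,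 let $F_1,F_2$ be any smooth functions on $U$ with $F_i|_{\mathcal M_\xi}=f_i\circ r_\xi$, and let $x\in\mathcal M_\xi$. There are vectors $V_{F_1},V_{F_2}$ tangent at $x$ to the $G$-orbit of $x$ (i.e. of the form $K_a(x)$, $a\in\mathfrak g$) such that $K_{F_i}(x)+V_{F_i}\in T_x\mathcal M_\xi$, and for every such choice $$\{f_1,f_2\}^r_\xi(r_\xi(x))=\{F_1,F_2\}(x)+\tfrac12\bigl(V_{F_1}F_2-V_{F_2}F_1\bigr).$$ -/

import Mathlib

open scoped Manifold ContDiff Topology Bundle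

noncomputable section

namespace SymplecticReduction

/-! ### Generalities on manifolds -/

section General

variable {F H : Type*} [NormedAddCommGroup F] [NormedSpace ℝ F] [TopologicalSpace H]
  (I : ModelWithCorners ℝ F H) {N : Type*} [TopologicalSpace N] [ChartedSpace H N]

/-- The exterior derivative `dθ` of a `1`-form `θ` on a manifold without boundary, at the point `x`:
in the chart `φ` at `x` it is `(X, Y) ↦ (D_X θ) Y - (D_Y θ) X`. -/
def extDerivOneForm (θ : ∀ y : N, TangentSpace I y →L[ℝ] ℝ) (x : N) (X Y : TangentSpace I x) : ℝ :=
  let φ := extChartAt I x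
  let θ' : F → F →L[ℝ] ℝ := fun z => (θ (φ.symm z)).comp (mfderiv 𝓘(ℝ, F) I φ.symm z)
  let A : TangentSpace I x →L[ℝ] F := mfderiv I 𝓘(ℝ, F) φ x
  fderiv ℝ θ' (φ x) (A X) (A Y) - fderiv ℝ θ' (φ x) (A Y) (A X)

/-- `γ` is a curve contained in the subset `S` of the manifold `N`, smooth at time `0`, which starts
at `x` with velocity `w`. -/
structure IsCurveIn (S : Set N) (x : N) (γ : ℝ → N) (w : TangentSpace I x) : Prop where
  mem : ∀ t, γ t ∈ S
  init : γ 0 = x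
  smooth : ContMDiffAt 𝓘(ℝ, ℝ) I ∞ γ 0
  velocity : (mfderiv 𝓘(ℝ, ℝ) I γ 0 (1 : ℝ) : F) = w

/-- The tangent space at `x` of an embedded submanifold `S ⊆ N`, as a subspace of `T_x N`:
it is spanned by the velocities of the smooth curves in `S` through `x`. -/
def tangentOf (S : Set N) (x : N) : Submodule ℝ (TangentSpace I x) :=
  Submodule.span ℝ {w | ∃ γ : ℝ → N, IsCurveIn I S x γ w}

end General

variable (E : Type*) [NormedAddCommGroup E] [NormedSpace ℝ E]
  (M : Type*) [TopologicalSpace M] [ChartedSpace E M]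

/-! ### The cotangent bundle and its symplectic structure -/

section Cotangent

/-- The cotangent bundle `T^*M` of a manifold `M` modelled on `E`; a point is a pair `⟨u, v⟩` with
`u : M` and `v` a linear form on `T_u M`. -/
abbrev Cotangent [IsManifold 𝓘(ℝ, E) 1 M] : Type _ :=
  Bundle.TotalSpace (E →L[ℝ] ℝ)
    (fun u : M => TangentSpace 𝓘(ℝ, E) u →L[ℝ] Bundle.Trivial M ℝ u)

/-- The model with corners of `T^*M`. -/
abbrev IT : ModelWithCorners ℝ (E × (E →L[ℝ] ℝ)) (ModelProd E (E →L[ℝ] ℝ)) :=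
  𝓘(ℝ, E).prod 𝓘(ℝ, E →L[ℝ] ℝ)

variable [IsManifold 𝓘(ℝ, E) ∞ M]

/-- The Liouville `1`-form `λ = ∑ v_j du^j` on `T^*M`: `λ_{(u,v)}(X) = v (dpr X)`, where
`pr : T^*M → M` is the projection. -/
def liouville (p : Cotangent E M) : TangentSpace (IT E) p →L[ℝ] ℝ :=
  ContinuousLinearMap.comp (p.2 : TangentSpace 𝓘(ℝ, E) p.1 →L[ℝ] ℝ)
    (mfderiv (IT E) 𝓘(ℝ, E) (fun q : Cotangent E M => q.1) p)

/-- The canonical symplectic form `ω = dλ` on `T^*M`. -/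
def omega (p : Cotangent E M) (X Y : TangentSpace (IT E) p) : ℝ :=
  extDerivOneForm (IT E) (liouville E M) p X Y

variable {E M}

/-- `dF_p(X)`, the derivative of the function `F` on `T^*M` along the tangent vector `X` at `p`. -/
def dirDeriv (F : Cotangent E M → ℝ) (p : Cotangent E M) (X : TangentSpace (IT E) p) : ℝ :=
  (mfderiv (IT E) 𝓘(ℝ, ℝ) F p X : ℝ)

/-- `K` is the value at `p` of the Hamiltonian vector field of `F`, i.e. `i_K ω = -dF` at `p`. -/
def IsHamiltonianVector (F : Cotangent E M → ℝ) (p : Cotangent E M)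
    (K : TangentSpace (IT E) p) : Prop :=
  ∀ Y : TangentSpace (IT E) p, omega E M p K Y = -dirDeriv F p Y

/-- The Hamiltonian vector field `K_F` of `F`. -/
def hamiltonianField (F : Cotangent E M → ℝ) (p : Cotangent E M) : TangentSpace (IT E) p :=
  Classical.epsilon (IsHamiltonianVector F p)

/-- The canonical Poisson bracket on `T^*M`, `{F₁, F₂} = ω(K_{F₁}, K_{F₂})`; in canonical
coordinates `{v_j, u^i} = δ_j^i`. -/
def poisson (F₁ F₂ : Cotangent E M → ℝ) (p : Cotangent E M) : ℝ :=
  omega E M p (hamiltonianField F₁ p) (hamiltonianField F₂ p)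

end Cotangent

/-! ### The cotangent lift of a smooth group action, and its momentum map -/

section Action

variable {E M} [IsManifold 𝓘(ℝ, E) ∞ M]
  {EG : Type*} [NormedAddCommGroup EG] [NormedSpace ℝ EG]
  {G : Type*} [TopologicalSpace G] [ChartedSpace EG G] [Group G]

/-- The adjoint action `Ad_g` of `g` on the Lie algebra `T_1 G`: the derivative at `1` of
`h ↦ g h g⁻¹`. -/
def adjoint (g : G) : GroupLieAlgebra 𝓘(ℝ, EG) G →L[ℝ] GroupLieAlgebra 𝓘(ℝ, EG) G :=
  (mfderiv 𝓘(ℝ, EG) 𝓘(ℝ, EG) (fun h : G => g * h * g⁻¹) 1 : EG →L[ℝ] EG)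

theorem adjoint_one : adjoint (EG := EG) (1 : G) = ContinuousLinearMap.id ℝ _ := by
  have h : (fun h : G => 1 * h * (1 : G)⁻¹) = id := by ext; simp
  unfold adjoint
  rw [h]
  exact mfderiv_id

theorem mfderiv_eq_of_eq {F₁ F₂ N₁ N₂ : Type*} [NormedAddCommGroup F₁] [NormedSpace ℝ F₁]
    [NormedAddCommGroup F₂] [NormedSpace ℝ F₂] [TopologicalSpace N₁] [ChartedSpace F₁ N₁]
    [TopologicalSpace N₂] [ChartedSpace F₂ N₂] {f f' : N₁ → N₂} {x x' : N₁} (hf : f = f')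
    (hx : x = x') :
    (mfderiv 𝓘(ℝ, F₁) 𝓘(ℝ, F₂) f x : F₁ →L[ℝ] F₂) = mfderiv 𝓘(ℝ, F₁) 𝓘(ℝ, F₂) f' x' := by
  subst hf; subst hx; rfl

theorem adjoint_mul [LieGroup 𝓘(ℝ, EG) ∞ G] (g h : G) :
    adjoint (EG := EG) (g * h) = (adjoint (EG := EG) g).comp (adjoint (EG := EG) h) := by
  have hs : ∀ k : G, MDifferentiable 𝓘(ℝ, EG) 𝓘(ℝ, EG) (fun x : G => k * x * k⁻¹) := fun k =>
    ((contMDiff_mul_right (I := 𝓘(ℝ, EG)) (n := ∞)).comp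
      (contMDiff_mul_left (I := 𝓘(ℝ, EG)) (n := ∞) (a := k))).mdifferentiable (by simp)
  have hc := mfderiv_comp (I := 𝓘(ℝ, EG)) (I' := 𝓘(ℝ, EG)) (I'' := 𝓘(ℝ, EG)) (1 : G)
    (hs g (h * 1 * h⁻¹)) (hs h 1)
  refine Eq.trans (mfderiv_eq_of_eq (f' := (fun x : G => g * x * g⁻¹) ∘ fun x : G => h * x * h⁻¹)
    (by ext x; simp [mul_assoc]) rfl) (hc.trans ?_)
  have h1 := mfderiv_eq_of_eq (F₁ := EG) (F₂ := EG) (f := fun x : G => g * x * g⁻¹)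
    (x := h * 1 * h⁻¹) rfl (show h * 1 * h⁻¹ = 1 by simp)
  exact congrArg (fun A : EG →L[ℝ] EG => A.comp (adjoint (EG := EG) h)) h1

/-- The isotropy group `G_ξ = {g | Ad^*_{g⁻¹} ξ = ξ}` of `ξ ∈ 𝔤^*` for the coadjoint action
`Ad^*_{g⁻¹} ξ = ξ ∘ Ad_{g⁻¹}`. -/
def isotropy [LieGroup 𝓘(ℝ, EG) ∞ G] (ξ : GroupLieAlgebra 𝓘(ℝ, EG) G →L[ℝ] ℝ) :
    Subgroup G where
  carrier := {g | ξ.comp (adjoint (EG := EG) g⁻¹) = ξ}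
  one_mem' := by
    simp only [Set.mem_ofPred_eq, inv_one, adjoint_one]; rfl
  mul_mem' {g h} hg hh := by
    simp only [Set.mem_ofPred_eq] at hg hh ⊢
    rw [mul_inv_rev, adjoint_mul, ← ContinuousLinearMap.comp_assoc, hh, hg]
  inv_mem' {g} hg := by
    simp only [Set.mem_ofPred_eq] at hg ⊢
    conv_lhs => rw [← hg]
    rw [ContinuousLinearMap.comp_assoc, ← adjoint_mul]
    simp only [inv_inv, inv_mul_cancel, adjoint_one]; rfl

/-- The cotangent lift of the diffeomorphism `u ↦ g • u`:
`(u, v) ↦ (g • u, v ∘ d(g⁻¹ • ·)_{g • u})`. -/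
def lift [MulAction G M] (g : G) (p : Cotangent E M) : Cotangent E M :=
  ⟨g • p.1, (ContinuousLinearMap.comp (p.2 : E →L[ℝ] ℝ)
    (mfderiv 𝓘(ℝ, E) 𝓘(ℝ, E) (fun y : M => g⁻¹ • y) (g • p.1) : E →L[ℝ] E) : E →L[ℝ] ℝ)⟩

/-- The value at `u` of the vector field `k_a` on `M` generated by `a`, as a linear function of `a`:
the derivative at `1` of `g ↦ g • u`. -/
def generatorBase [MulAction G M] (u : M) :
    GroupLieAlgebra 𝓘(ℝ, EG) G →L[ℝ] TangentSpace 𝓘(ℝ, E) u :=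
  (mfderiv 𝓘(ℝ, EG) 𝓘(ℝ, E) (fun g : G => g • u) 1 : EG →L[ℝ] E)

/-- The value at `p` of the vector field `K_a` on `T^*M` generated by `a`, as a linear function
of `a`: the derivative at `1` of the orbit map `g ↦ g • p` of the lifted action. -/
def generator [MulAction G M] (p : Cotangent E M) :
    GroupLieAlgebra 𝓘(ℝ, EG) G →L[ℝ] TangentSpace (IT E) p :=
  (mfderiv 𝓘(ℝ, EG) (IT E) (fun g : G => lift g p) 1 : EG →L[ℝ] E × (E →L[ℝ] ℝ))

/-- The momentum map `l : T^*M → 𝔤^*`, `⟨l(u,v), a⟩ = v (k_a(u))`. -/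
def momentum [MulAction G M] (p : Cotangent E M) : GroupLieAlgebra 𝓘(ℝ, EG) G →L[ℝ] ℝ :=
  ContinuousLinearMap.comp (p.2 : TangentSpace 𝓘(ℝ, E) p.1 →L[ℝ] ℝ) (generatorBase p.1)

/-- The level set `M_ξ = l⁻¹(ξ)`. -/
def levelSet (E M : Type*) [NormedAddCommGroup E] [NormedSpace ℝ E] [TopologicalSpace M]
    [ChartedSpace E M] [IsManifold 𝓘(ℝ, E) ∞ M] [MulAction G M]
    (ξ : GroupLieAlgebra 𝓘(ℝ, EG) G →L[ℝ] ℝ) : Set (Cotangent E M) :=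
  {p | momentum p = ξ}

section Helper

set_option linter.unusedSectionVars false

variable (EG) [MulAction G M]

theorem mdifferentiable_smul [ContMDiffSMul 𝓘(ℝ, EG) 𝓘(ℝ, E) ∞ G M] (g : G) :
    MDifferentiable 𝓘(ℝ, E) 𝓘(ℝ, E) (fun y : M => g • y) := by
  have h : ContMDiff 𝓘(ℝ, E) 𝓘(ℝ, E) ∞ (fun y : M => g • y) :=
    (ContMDiffSMul.contMDiff_smul (I := 𝓘(ℝ, EG)) (I' := 𝓘(ℝ, E)) (n := ∞) (G := G) (M := M)).comp
      (contMDiff_const.prodMk contMDiff_id)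
  exact h.mdifferentiable (by simp)

theorem mdifferentiable_orbitMap [ContMDiffSMul 𝓘(ℝ, EG) 𝓘(ℝ, E) ∞ G M] (u : M) :
    MDifferentiable 𝓘(ℝ, EG) 𝓘(ℝ, E) (fun g : G => g • u) := by
  have h : ContMDiff 𝓘(ℝ, EG) 𝓘(ℝ, E) ∞ (fun g : G => g • u) :=
    (ContMDiffSMul.contMDiff_smul (I := 𝓘(ℝ, EG)) (I' := 𝓘(ℝ, E)) (n := ∞) (G := G) (M := M)).comp
      (contMDiff_id.prodMk contMDiff_const)
  exact h.mdifferentiable (by simp)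

theorem cotangent_ext {u u' : M} (v : TangentSpace 𝓘(ℝ, E) u →L[ℝ] ℝ)
    (v' : TangentSpace 𝓘(ℝ, E) u' →L[ℝ] ℝ) (hu : u = u')
    (hv : (v : E →L[ℝ] ℝ) = (v' : E →L[ℝ] ℝ)) : (⟨u, v⟩ : Cotangent E M) = ⟨u', v'⟩ := by
  subst hu; subst hv; rfl

theorem lift_one (p : Cotangent E M) : lift (1 : G) p = p := by
  refine cotangent_ext _ _ (one_smul G p.1) ?_
  have h : (mfderiv 𝓘(ℝ, E) 𝓘(ℝ, E) (fun y : M => (1 : G)⁻¹ • y) ((1 : G) • p.1) : E →L[ℝ] E) =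
      ContinuousLinearMap.id ℝ E :=
    (mfderiv_eq_of_eq (f' := id) (by ext y; simp) (one_smul G p.1)).trans mfderiv_id
  rw [h]; rfl

theorem lift_mul [ContMDiffSMul 𝓘(ℝ, EG) 𝓘(ℝ, E) ∞ G M]
    (g h : G) (p : Cotangent E M) : lift (g * h) p = lift g (lift h p) := by
  refine cotangent_ext _ _ (mul_smul g h p.1) ?_
  have hc := mfderiv_comp (I := 𝓘(ℝ, E)) (I' := 𝓘(ℝ, E)) (I'' := 𝓘(ℝ, E)) (g • h • p.1)
    (mdifferentiable_smul EG (E := E) h⁻¹ (g⁻¹ • g • h • p.1))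
    (mdifferentiable_smul EG (E := E) g⁻¹ (g • h • p.1))
  have h1 : (mfderiv 𝓘(ℝ, E) 𝓘(ℝ, E) (fun y : M => (g * h)⁻¹ • y) ((g * h) • p.1) : E →L[ℝ] E) =
      mfderiv 𝓘(ℝ, E) 𝓘(ℝ, E) ((fun y : M => h⁻¹ • y) ∘ (fun y : M => g⁻¹ • y)) (g • h • p.1) :=
    mfderiv_eq_of_eq (by ext y; simp [mul_smul]) (mul_smul g h p.1)
  have h2 : (mfderiv 𝓘(ℝ, E) 𝓘(ℝ, E) (fun y : M => h⁻¹ • y) (g⁻¹ • g • h • p.1) : E →L[ℝ] E) =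
      mfderiv 𝓘(ℝ, E) 𝓘(ℝ, E) (fun y : M => h⁻¹ • y) (h • p.1) :=
    mfderiv_eq_of_eq rfl (by simp)
  have h3 := h1.trans (hc.trans (congrArg (fun A : E →L[ℝ] E => A.comp
    (mfderiv 𝓘(ℝ, E) 𝓘(ℝ, E) (fun y : M => g⁻¹ • y) (g • h • p.1) : E →L[ℝ] E)) h2))
  exact congrArg (fun A : E →L[ℝ] E => (ContinuousLinearMap.comp (p.2 : E →L[ℝ] ℝ) A)) h3

/-- The momentum map is equivariant: `l(g • p) = Ad^*_{g⁻¹} l(p)`. -/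
theorem momentum_lift [LieGroup 𝓘(ℝ, EG) ∞ G] [ContMDiffSMul 𝓘(ℝ, EG) 𝓘(ℝ, E) ∞ G M]
    (g : G) (p : Cotangent E M) :
    momentum (EG := EG) (lift g p) = (momentum p).comp (adjoint (EG := EG) g⁻¹) := by
  have hs : MDifferentiable 𝓘(ℝ, EG) 𝓘(ℝ, EG) (fun x : G => g⁻¹ * x * (g⁻¹)⁻¹) :=
    ((contMDiff_mul_right (I := 𝓘(ℝ, EG)) (n := ∞)).comp
      (contMDiff_mul_left (I := 𝓘(ℝ, EG)) (n := ∞) (a := g⁻¹))).mdifferentiable (by simp)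
  have hc1 := mfderiv_comp (I := 𝓘(ℝ, EG)) (I' := 𝓘(ℝ, E)) (I'' := 𝓘(ℝ, E)) (1 : G)
    (mdifferentiable_smul EG (E := E) g⁻¹ ((1 : G) • g • p.1))
    (mdifferentiable_orbitMap EG (E := E) (g • p.1) 1)
  have hc2 := mfderiv_comp (I := 𝓘(ℝ, EG)) (I' := 𝓘(ℝ, EG)) (I'' := 𝓘(ℝ, E)) (1 : G)
    (mdifferentiable_orbitMap EG (E := E) p.1 (g⁻¹ * 1 * (g⁻¹)⁻¹)) (hs 1)
  have h0 : (mfderiv 𝓘(ℝ, EG) 𝓘(ℝ, E) ((fun y : M => g⁻¹ • y) ∘ fun x : G => x • g • p.1) 1 :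
      EG →L[ℝ] E) = mfderiv 𝓘(ℝ, EG) 𝓘(ℝ, E)
        ((fun x : G => x • p.1) ∘ fun x : G => g⁻¹ * x * (g⁻¹)⁻¹) 1 :=
    mfderiv_eq_of_eq (by ext x; simp [mul_smul]) rfl
  have h1 : (mfderiv 𝓘(ℝ, E) 𝓘(ℝ, E) (fun y : M => g⁻¹ • y) ((1 : G) • g • p.1) : E →L[ℝ] E) =
      mfderiv 𝓘(ℝ, E) 𝓘(ℝ, E) (fun y : M => g⁻¹ • y) (g • p.1) :=
    mfderiv_eq_of_eq rfl (one_smul G _)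
  have h2 : (mfderiv 𝓘(ℝ, EG) 𝓘(ℝ, E) (fun x : G => x • p.1) (g⁻¹ * 1 * (g⁻¹)⁻¹) : EG →L[ℝ] E) =
      mfderiv 𝓘(ℝ, EG) 𝓘(ℝ, E) (fun x : G => x • p.1) 1 :=
    mfderiv_eq_of_eq rfl (by simp)
  have h3 := (congrArg (fun A : E →L[ℝ] E => A.comp
    (mfderiv 𝓘(ℝ, EG) 𝓘(ℝ, E) (fun x : G => x • g • p.1) 1 : EG →L[ℝ] E)) h1).symm.trans
      (hc1.symm.trans (h0.trans (hc2.trans (congrArg (fun A : EG →L[ℝ] E => A.comp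
        (adjoint (EG := EG) g⁻¹ : EG →L[ℝ] EG)) h2))))
  exact congrArg (fun A : EG →L[ℝ] E => (ContinuousLinearMap.comp (p.2 : E →L[ℝ] ℝ) A)) h3

end Helper

end Action

/-! ### The reduced space `M_ξ / G_ξ` and its Poisson bracket -/

section Reduced

variable {E M} [IsManifold 𝓘(ℝ, E) ∞ M]
  {EG : Type*} [NormedAddCommGroup EG] [NormedSpace ℝ EG]
  {G : Type*} [TopologicalSpace G] [ChartedSpace EG G] [Group G] [LieGroup 𝓘(ℝ, EG) ∞ G]
  [MulAction G M] [ContMDiffSMul 𝓘(ℝ, EG) 𝓘(ℝ, E) ∞ G M]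
  (ξ : GroupLieAlgebra 𝓘(ℝ, EG) G →L[ℝ] ℝ)

/-- The action of `G_ξ` on `M_ξ` by cotangent lifts. -/
instance : MulAction (isotropy ξ) (levelSet E M ξ) where
  smul g p := ⟨lift (g : G) (p : Cotangent E M),
    (momentum_lift EG (g : G) (p : Cotangent E M)).trans
      ((congrArg (fun η : GroupLieAlgebra 𝓘(ℝ, EG) G →L[ℝ] ℝ => η.comp (adjoint (g : G)⁻¹))
        p.2).trans g.2)⟩
  one_smul p := Subtype.ext (lift_one (p : Cotangent E M))
  mul_smul g h p := Subtype.ext (lift_mul EG (g : G) (h : G) (p : Cotangent E M))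

/-- `ξ` is a regular value of the momentum map. -/
def IsRegularMomentum (E M : Type*) [NormedAddCommGroup E] [NormedSpace ℝ E] [TopologicalSpace M]
    [ChartedSpace E M] [IsManifold 𝓘(ℝ, E) ∞ M] [MulAction G M]
    (ξ : GroupLieAlgebra 𝓘(ℝ, EG) G →L[ℝ] ℝ) : Prop :=
  ∀ p ∈ levelSet E M ξ, Function.Surjective
    (mfderiv (IT E) 𝓘(ℝ, EG →L[ℝ] ℝ)
      (show Cotangent E M → (EG →L[ℝ] ℝ) from momentum (EG := EG) (G := G)) p)

/-- The reduced space `M_ξ / G_ξ`. -/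
abbrev ReducedSpace (E M : Type*) [NormedAddCommGroup E] [NormedSpace ℝ E] [TopologicalSpace M]
    [ChartedSpace E M] [IsManifold 𝓘(ℝ, E) ∞ M] [MulAction G M]
    [ContMDiffSMul 𝓘(ℝ, EG) 𝓘(ℝ, E) ∞ G M]
    (ξ : GroupLieAlgebra 𝓘(ℝ, EG) G →L[ℝ] ℝ) : Type _ :=
  MulAction.orbitRel.Quotient (isotropy ξ) (levelSet E M ξ)

variable {ξ}

/-- The projection `r_ξ : M_ξ → M_ξ / G_ξ`. -/
def reduce (x : levelSet E M ξ) : ReducedSpace E M ξ :=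
  Quotient.mk (MulAction.orbitRel (isotropy ξ) (levelSet E M ξ)) x

/-- `F` is a smooth function on the open set `U ⊆ T^*M` that extends (the pullback to `M_ξ ∩ U` of)
the function `f` on `M_ξ / G_ξ`. -/
structure IsExtension (f : ReducedSpace E M ξ → ℝ) (U : Set (Cotangent E M))
    (F : Cotangent E M → ℝ) : Prop where
  isOpen : IsOpen U
  smooth : ContMDiffOn (IT E) 𝓘(ℝ, ℝ) ∞ F U
  eq : ∀ y : levelSet E M ξ, (y : Cotangent E M) ∈ U → F y = f (reduce y)

/-- A function on `M_ξ / G_ξ` is smooth if its pullback to `M_ξ` is a smooth function on the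
submanifold `M_ξ` of `T^*M`, i.e. is locally the restriction of a smooth function on `T^*M`. -/
def IsSmoothReduced (f : ReducedSpace E M ξ → ℝ) : Prop :=
  ∀ x : levelSet E M ξ, ∃ (U : Set (Cotangent E M)) (F : Cotangent E M → ℝ),
    (x : Cotangent E M) ∈ U ∧ IsExtension f U F

/-- `T_x M_ξ`. -/
def levelTangent (x : levelSet E M ξ) : Submodule ℝ (TangentSpace (IT E) (x : Cotangent E M)) :=
  tangentOf (IT E) (levelSet E M ξ) (x : Cotangent E M)

/-- `T_x Or(G)`, the tangent space to the `G`-orbit of `x`: the vectors `K_a(x)`, `a ∈ 𝔤`. -/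
def orbitTangent (x : levelSet E M ξ) : Submodule ℝ (TangentSpace (IT E) (x : Cotangent E M)) :=
  LinearMap.range (generator (EG := EG) (G := G) (x : Cotangent E M) :
    GroupLieAlgebra 𝓘(ℝ, EG) G →ₗ[ℝ] TangentSpace (IT E) (x : Cotangent E M))

/-- `T_x Or(G_ξ)`, the tangent space to the `G_ξ`-orbit of `x`: the vectors `K_a(x)` with `a` in the
Lie algebra `T_1 G_ξ` of `G_ξ`. -/
def isotropyOrbitTangent (x : levelSet E M ξ) :
    Submodule ℝ (TangentSpace (IT E) (x : Cotangent E M)) :=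
  (tangentOf 𝓘(ℝ, EG) (isotropy ξ : Set G) 1).map
    (generator (EG := EG) (G := G) (x : Cotangent E M) :
      GroupLieAlgebra 𝓘(ℝ, EG) G →ₗ[ℝ] TangentSpace (IT E) (x : Cotangent E M))

/-- The tangent space of `M_ξ / G_ξ` at `r_ξ(x)`, as the quotient `T_x M_ξ / T_x Or(G_ξ)`. -/
abbrev ReducedTangent (x : levelSet E M ξ) : Type _ :=
  levelTangent x ⧸ (isotropyOrbitTangent x).submoduleOf (levelTangent x)

/-- The projection `T_x M_ξ → T_{r_ξ(x)} (M_ξ / G_ξ)`. -/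
def reduceTangent (x : levelSet E M ξ) : levelTangent x →ₗ[ℝ] ReducedTangent x :=
  Submodule.mkQ _

/-- `B` is the value at `r_ξ(x)` of the reduced symplectic form `ω̄_ξ`, defined by
`r_ξ^* ω̄_ξ = ω` on `M_ξ`. -/
structure IsReducedForm (x : levelSet E M ξ) (B : LinearMap.BilinForm ℝ (ReducedTangent x)) :
    Prop where
  pullback : ∀ η₁ η₂ : levelTangent x,
    B (reduceTangent x η₁) (reduceTangent x η₂) = omega E M (x : Cotangent E M) η₁ η₂
  nondegenerate : B.Nondegenerate

/-- `K` is the value at `r_ξ(x)` of the Hamiltonian vector field of the function `f` on `M_ξ / G_ξ`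
for the form `B`, i.e. `i_K B = -df`; the derivative of `f` along a tangent vector is computed
along a curve in `M_ξ` that represents it. -/
def IsReducedHamiltonianVector (x : levelSet E M ξ) (B : LinearMap.BilinForm ℝ (ReducedTangent x))
    (f : ReducedSpace E M ξ → ℝ) (K : ReducedTangent x) : Prop :=
  ∀ (γ : ℝ → Cotangent E M) (η : levelTangent x)
    (hγ : IsCurveIn (IT E) (levelSet E M ξ) (x : Cotangent E M) γ η),
    B K (reduceTangent x η) = -deriv (fun t => f (reduce ⟨γ t, hγ.mem t⟩)) 0

/-- `h` is the reduced Poisson bracket of the functions `f₁, f₂` on `M_ξ / G_ξ`: at each point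
`h = ω̄_ξ(K_{f₁}, K_{f₂})`. -/
def IsReducedBracket (f₁ f₂ h : ReducedSpace E M ξ → ℝ) : Prop :=
  ∀ x : levelSet E M ξ, ∃ (B : LinearMap.BilinForm ℝ (ReducedTangent x)) (K₁ K₂ : ReducedTangent x),
    IsReducedForm x B ∧ IsReducedHamiltonianVector x B f₁ K₁ ∧
      IsReducedHamiltonianVector x B f₂ K₂ ∧ h (reduce x) = B K₁ K₂

/-- `V` is a correction vector at `x ∈ M_ξ` for the function `F` near `x`: it is tangent to the
`G`-orbit of `x`, and `K_F + V` is tangent to `M_ξ`. -/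
structure IsCorrection (F : Cotangent E M → ℝ) (x : levelSet E M ξ)
    (V : TangentSpace (IT E) (x : Cotangent E M)) : Prop where
  tangent_orbit : V ∈ orbitTangent x
  tangent_level : hamiltonianField F (x : Cotangent E M) + V ∈ levelTangent x

end Reduced

end SymplecticReduction

end

open SymplecticReduction

/-!
The argument rests on a few linear facts about the tangent space `T = T_x(T^*M)` at a point `x` of
the level set, proved from the geometry of the cotangent bundle.

In a bundle chart the Liouville form is `∑ v_j du^j` (`liouville_chart`), so `ω` is the standard
symplectic form of the model space `E × E^*` (`omega_eq`). The lifted action preserves the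
Liouville form, hence `ω` (`omega_lift`), and `i_{K_a} ω = -d⟨l, a⟩` (`omega_generator`). The last
identity says that the kernel of `dl_x` is the symplectic orthogonal of `O = T_x Or(G)`.

* Since `ξ` is a regular value, the implicit function theorem gives `T_x M_ξ = ker dl_x = Oᗮ`, and
  every vector in it is the velocity of a curve in `M_ξ` (`exists_isCurveIn_level`).
* `T_x Or(G_ξ) = O ∩ Oᗮ` (`mem_isotropyOrbitTangent_iff`): if `K_a(x)` is tangent to the level set,
  equivariance makes `l` constant along the curve `γ x`, where `γ` is the integral curve through `1`
  of the left-invariant field of `a`; so `γ` stays in `G_ξ`.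

As `Oᗮᗮ = O`, the kernel of `ω` on `T_x M_ξ` is `T_x Or(G_ξ)`, so `ω` descends to a nondegenerate
form (`exists_isReducedForm`). An extension `F` of `f ∘ r_ξ` is stationary along `G_ξ`-orbits, so
`K_F` is orthogonal to `O ∩ Oᗮ` and lies in `(O ∩ Oᗮ)ᗮ = O + Oᗮ`: there is a `V ∈ O` with
`K_F + V ∈ T_x M_ξ` (`IsExtension.exists_isCorrection`). Since `V` is orthogonal to `T_x M_ξ`, the
vector `K_F + V` represents the reduced Hamiltonian vector of `f`
(`IsCorrection.isLevelHamiltonian`). The reduced bracket is therefore `ω(K_1 + V_1, K_2 + V_2)`; it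
is constant on `G_ξ`-orbits because the action preserves `ω` and the level set. In the expansion of
this product, `ω(V_i, K_j + V_j) = 0` turns the correction terms into `½ (V_1 F_2 - V_2 F_1)`
(`symplecticForm_add_add_eq`). Extensions exist by a partition of unity on `T^*M`
(`exists_isExtension_univ`).
-/

namespace SymplecticReduction

/-! ### Calculus and linear algebra in vector spaces -/

section VectorSpace

/-- Naturality of the exterior derivative for a one-form `y ↦ Θ y` that depends linearly on the
point: the exterior derivative of its pullback along `Φ` is the pullback of the two-form
`(X, Y) ↦ Θ X Y - Θ Y X`. The second derivative of `Φ` drops out because it is symmetric. -/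
theorem fderiv_pullback_sub {Z F : Type*} [NormedAddCommGroup Z] [NormedSpace ℝ Z]
    [NormedAddCommGroup F] [NormedSpace ℝ F] (Θ : F →L[ℝ] F →L[ℝ] ℝ) {Φ : Z → F} {z : Z}
    (hΦ : ContDiffAt ℝ 2 Φ z) (X Y : Z) :
    fderiv ℝ (fun y => (Θ (Φ y)).comp (fderiv ℝ Φ y)) z X Y -
        fderiv ℝ (fun y => (Θ (Φ y)).comp (fderiv ℝ Φ y)) z Y X =
      Θ (fderiv ℝ Φ z X) (fderiv ℝ Φ z Y) - Θ (fderiv ℝ Φ z Y) (fderiv ℝ Φ z X) := by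
  have h1 : HasFDerivAt Φ (fderiv ℝ Φ z) z := (hΦ.differentiableAt (by simp)).hasFDerivAt
  have h2 : HasFDerivAt (fderiv ℝ Φ) (fderiv ℝ (fderiv ℝ Φ) z) z :=
    ((hΦ.fderiv_right (m := 1) le_rfl).differentiableAt (by simp)).hasFDerivAt
  have h3 := (Θ.hasFDerivAt.comp z h1).clm_comp h2
  have h4 : fderiv ℝ (fun y => (Θ (Φ y)).comp (fderiv ℝ Φ y)) z = _ := h3.fderiv
  have hs : IsSymmSndFDerivAt ℝ Φ z := hΦ.isSymmSndFDerivAt (by simp)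
  rw [h4]
  simp [hs X Y]

theorem differentiableAt_pullback {Z F : Type*} [NormedAddCommGroup Z] [NormedSpace ℝ Z]
    [NormedAddCommGroup F] [NormedSpace ℝ F] (Θ : F →L[ℝ] F →L[ℝ] ℝ) {Φ : Z → F} {z : Z}
    (hΦ : ContDiffAt ℝ 2 Φ z) :
    DifferentiableAt ℝ (fun y => (Θ (Φ y)).comp (fderiv ℝ Φ y)) z :=
  (Θ.differentiableAt.comp z (hΦ.differentiableAt (by simp))).clm_comp
    ((hΦ.fderiv_right (m := 1) le_rfl).differentiableAt (by simp))

/-- The derivative of a differentiable one-form, evaluated at fixed vectors, is computed along a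
straight line. -/
theorem fderiv_apply_eq_of_hasDerivAt {Z : Type*} [NormedAddCommGroup Z] [NormedSpace ℝ Z]
    {α : Z → Z →L[ℝ] ℝ} {z : Z} (hα : DifferentiableAt ℝ α z) {X Y : Z} {c : ℝ}
    (h : HasDerivAt (fun t : ℝ => α (z + t • X) Y) c 0) : fderiv ℝ α z X Y = c := by
  have h1 : HasDerivAt (fun t : ℝ => z + t • X) X 0 := by
    simpa using ((hasDerivAt_id (0 : ℝ)).smul_const X).const_add z
  have h2 : HasFDerivAt α (fderiv ℝ α z) (z + (0 : ℝ) • X) := by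
    simpa using hα.hasFDerivAt
  have h3 := (ContinuousLinearMap.apply ℝ ℝ Y).hasFDerivAt.comp_hasDerivAt (0 : ℝ)
    (h2.comp_hasDerivAt (0 : ℝ) h1)
  exact h3.unique h

theorem fderiv_eq_of_eventuallyEq_clm {F G : Type*} [NormedAddCommGroup F] [NormedSpace ℝ F]
    [NormedAddCommGroup G] [NormedSpace ℝ G] {f : F → G} {A : F →L[ℝ] G} {z : F}
    (h : f =ᶠ[𝓝 z] A) : fderiv ℝ f z = A :=
  h.fderiv_eq.trans A.fderiv

/-- The solutions of the autonomous differential equation of a smooth vector field are smooth. -/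
theorem contDiffAt_of_hasDerivAt_vectorField {F : Type*} [NormedAddCommGroup F] [NormedSpace ℝ F]
    {X : F → F} {c : ℝ → F} {t : ℝ} (hX : ContDiffAt ℝ ∞ X (c t))
    (hc : ∀ᶠ s in 𝓝 t, HasDerivAt c (X (c s)) s) : ContDiffAt ℝ ∞ c t := by
  rw [contDiffAt_infty]
  intro n
  have hX' : ContDiffAt ℝ n X (c t) := hX.of_le (by exact_mod_cast le_top)
  induction n with
  | zero =>
    exact contDiffAt_zero.2 ⟨_, hc, fun s hs => (HasDerivAt.continuousAt hs).continuousWithinAt⟩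
  | succ k ih =>
    have hk := ih (hX'.of_le (by exact_mod_cast k.le_succ))
    refine contDiffAt_succ_iff_hasFDerivAt.2
      ⟨fun s => ContinuousLinearMap.toSpanSingleton ℝ (X (c s)), ⟨_, hc, fun s hs => ?_⟩, ?_⟩
    · exact (show HasDerivAt c (X (c s)) s from hs).hasFDerivAt
    · have h : ContDiffAt ℝ k (X ∘ c) t :=
        (hX'.of_le (by exact_mod_cast k.le_succ)).comp t hk
      exact (ContinuousLinearMap.toSpanSingletonCLE (𝕜 := ℝ) (E := F)).contDiff.contDiffAt.comp t h

/-- Every vector in the kernel of the derivative of a submersion is the velocity of a smooth curve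
in the fibre. -/
theorem exists_curve_in_fiber {F W : Type*} [NormedAddCommGroup F] [NormedSpace ℝ F]
    [NormedAddCommGroup W] [NormedSpace ℝ W] [FiniteDimensional ℝ W]
    {l : F → W} {z w : F} (hl : ContDiffAt ℝ ∞ l z)
    (hsurj : Function.Surjective (fderiv ℝ l z)) (hw : fderiv ℝ l z w = 0) :
    ∃ c : ℝ → F, ContDiffAt ℝ ∞ c 0 ∧ c 0 = z ∧ HasDerivAt c w 0 ∧ ∀ᶠ t in 𝓝 0, l (c t) = l z := by
  have := FiniteDimensional.complete ℝ W
  -- A right inverse of the derivative spans a complement along which `z + t w` is corrected.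
  obtain ⟨R, hR⟩ := (fderiv ℝ l z).exists_rightInverse_of_surjective
    (LinearMap.range_eq_top.2 hsurj)
  set A : ℝ × W →L[ℝ] F :=
    (ContinuousLinearMap.toSpanSingleton ℝ w).coprod R with hA
  set f : ℝ × W → W := fun p => l (z + A p) with hf
  have hz : z + A (0 : ℝ × W) = z := by simp
  have hl' : ContDiffAt ℝ ∞ l (z + A (0 : ℝ × W)) := by rwa [hz]
  have hcf : ContDiffAt ℝ ∞ f (0 : ℝ × W) :=
    hl'.comp (0 : ℝ × W) (contDiffAt_const.add A.contDiff.contDiffAt)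
  have hd : HasFDerivAt f ((fderiv ℝ l z).comp A) (0 : ℝ × W) := by
    have h1 : HasFDerivAt l (fderiv ℝ l z) (z + A (0 : ℝ × W)) := by
      rw [hz]; exact (hl.differentiableAt (by simp)).hasFDerivAt
    exact h1.comp (0 : ℝ × W) (A.hasFDerivAt.const_add z)
  have hinr : fderiv ℝ f (0 : ℝ × W) ∘L .inr ℝ ℝ W = ContinuousLinearMap.id ℝ W := by
    rw [hd.fderiv]
    ext s
    have := congrArg (fun B : W →L[ℝ] W => B s) hR
    simpa [hA] using this
  have hinl : fderiv ℝ f (0 : ℝ × W) ∘L .inl ℝ ℝ W = 0 := by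
    rw [hd.fderiv]
    ext
    simp [hA, hw]
  have hinv : (fderiv ℝ f (0 : ℝ × W) ∘L .inr ℝ ℝ W).IsInvertible := by
    rw [hinr]; exact ⟨ContinuousLinearEquiv.refl ℝ W, rfl⟩
  have hne : (∞ : WithTop ℕ∞) ≠ 0 := by simp
  set ψ := hcf.implicitFunction hne hinv with hψ
  have h0 : ψ 0 = 0 := hcf.implicitFunction_apply_self hne hinv
  have h1 : ContDiffAt ℝ ∞ ψ (0 : ℝ) := hcf.contDiffAt_implicitFunction hne hinv
  have h2 : HasFDerivAt ψ (0 : ℝ →L[ℝ] W) 0 := by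
    have := (hcf.hasStrictFDerivAt_implicitFunction hne hinv).hasFDerivAt
    rw [hinl, ContinuousLinearMap.comp_zero, neg_zero] at this
    exact this
  have h3 : ∀ᶠ t in 𝓝 (0 : ℝ), f (t, ψ t) = f (0 : ℝ × W) :=
    hcf.eventually_apply_implicitFunction hne hinv
  refine ⟨fun t => z + A (t, ψ t), ?_, ?_, ?_, ?_⟩
  · exact contDiffAt_const.add (A.contDiff.contDiffAt.comp _ (contDiffAt_id.prodMk h1))
  · change z + A (0, ψ 0) = z
    rw [h0]
    exact hz
  · have := (A.hasFDerivAt.comp (0 : ℝ) ((hasFDerivAt_id (0 : ℝ)).prodMk h2)).const_add z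
    simpa [hA] using this.hasDerivAt
  · filter_upwards [h3] with t ht
    simpa [hf, hz] using ht

variable {V : Type*} [AddCommGroup V] [Module ℝ V] [FiniteDimensional ℝ V]
  {B : LinearMap.BilinForm ℝ V}

/-- In a symplectic vector space, a vector that is orthogonal to `O ∩ Oᗮ` lies in `O + Oᗮ`. -/
theorem exists_add_mem_orthogonal (hB : B.Nondegenerate) (hr : B.IsRefl) (O : Submodule ℝ V) {k : V}
    (hk : ∀ y ∈ O, y ∈ B.orthogonal O → B y k = 0) : ∃ o ∈ O, k + o ∈ B.orthogonal O := by
  have h : k ∈ B.orthogonal (B.orthogonal (O ⊔ B.orthogonal O)) := by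
    intro y hy
    refine hk y ?_ ?_
    · rw [← LinearMap.BilinForm.orthogonal_orthogonal hB hr O]
      exact fun n hn => hy n (Submodule.mem_sup_right hn)
    · exact fun n hn => hy n (Submodule.mem_sup_left hn)
  rw [LinearMap.BilinForm.orthogonal_orthogonal hB hr] at h
  obtain ⟨o, ho, w, hw, rfl⟩ := Submodule.mem_sup.1 h
  exact ⟨-o, O.neg_mem ho, by simpa using hw⟩

end VectorSpace

/-! ### Canonical coordinates on the cotangent bundle -/

section Coordinates

/-- A one-form that is given in the chart at `x` by a bilinear form `A` has exterior derivative
`(X, Y) ↦ A X Y - A Y X` at `x`. -/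
theorem extDerivOneForm_eq {F H : Type*} [NormedAddCommGroup F] [NormedSpace ℝ F]
    [TopologicalSpace H] (I : ModelWithCorners ℝ F H) {N : Type*} [TopologicalSpace N]
    [ChartedSpace H N] [IsManifold I 1 N] (θ : ∀ y : N, TangentSpace I y →L[ℝ] ℝ) (x : N)
    (A : F →L[ℝ] F →L[ℝ] ℝ)
    (h : ∀ᶠ z in 𝓝 (extChartAt I x x), (θ ((extChartAt I x).symm z)).comp
      (mfderiv 𝓘(ℝ, F) I (extChartAt I x).symm z) = A z) (X Y : TangentSpace I x) :
    extDerivOneForm I θ x X Y = A X Y - A Y X := by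
  have h1 : fderiv ℝ (fun z => (θ ((extChartAt I x).symm z)).comp
      (mfderiv 𝓘(ℝ, F) I (extChartAt I x).symm z) : F → F →L[ℝ] ℝ) (extChartAt I x x) = A :=
    fderiv_eq_of_eventuallyEq_clm h
  have h2 : ∀ Z : F, (mfderiv I 𝓘(ℝ, F) (extChartAt I x) x : F →L[ℝ] F) Z = Z :=
    fun Z => DFunLike.congr_fun (mfderiv_extChartAt_self (I := I) (x := x)) Z
  have h3 : ∀ Z W : F, fderiv ℝ (fun z => (θ ((extChartAt I x).symm z)).comp
      (mfderiv 𝓘(ℝ, F) I (extChartAt I x).symm z) : F → F →L[ℝ] ℝ) (extChartAt I x x)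
        ((mfderiv I 𝓘(ℝ, F) (extChartAt I x) x : F →L[ℝ] F) Z)
        ((mfderiv I 𝓘(ℝ, F) (extChartAt I x) x : F →L[ℝ] F) W) = A Z W := by
    intro Z W
    rw [h2, h2, h1]
  exact congrArg₂ (· - ·) (h3 X Y) (h3 Y X)

variable {E : Type*} [NormedAddCommGroup E] [NormedSpace ℝ E]
  {M : Type*} [TopologicalSpace M] [ChartedSpace E M] [IsManifold 𝓘(ℝ, E) ∞ M]

theorem contMDiff_proj : ContMDiff (IT E) 𝓘(ℝ, E) ∞ (fun q : Cotangent E M => q.1) :=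
  Bundle.contMDiff_proj _

theorem mem_source_iff (p q : Cotangent E M) :
    q ∈ (extChartAt (IT E) p).source ↔ q.1 ∈ (chartAt E p.1).source := by
  rw [extChartAt_source]
  simp only [FiberBundle.chartedSpace_chartAt, mfld_simps, and_true]
  exact ⟨fun h => h.1.1, fun h => ⟨⟨h, Set.mem_univ _⟩, h⟩⟩

/-- The fibre coordinate of a covector in the bundle chart at `p` is its pullback along the inverse
of the chart of the base. -/
theorem extChartAt_cotangent_snd (p q : Cotangent E M) (hq : q.1 ∈ (chartAt E p.1).source) :
    (extChartAt (IT E) p q).2 = (q.2 : E →L[ℝ] ℝ).comp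
      (mfderiv 𝓘(ℝ, E) 𝓘(ℝ, E) (extChartAt 𝓘(ℝ, E) p.1).symm (extChartAt 𝓘(ℝ, E) p.1 q.1) :
        E →L[ℝ] E) := by
  have h := TangentBundle.symmL_trivializationAt (I := 𝓘(ℝ, E)) hq
  simp only [ModelWithCorners.range_eq_univ, mfderivWithin_univ] at h
  have h1 := Bundle.Trivial.continuousLinearMapAt_trivialization ℝ M ℝ q.1
  refine (congrArg (fun A : ℝ →L[ℝ] ℝ => A.comp ((q.2 : E →L[ℝ] ℝ).comp
    ((trivializationAt E (TangentSpace 𝓘(ℝ, E)) p.1).symmL ℝ q.1 : E →L[ℝ] E))) h1).trans ?_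
  exact congrArg (fun A : E →L[ℝ] E => (q.2 : E →L[ℝ] ℝ).comp A) h

/-- The bilinear form `((q, v), (a, b)) ↦ v a`, which is the Liouville form in canonical
coordinates. -/
noncomputable def canonicalForm (E : Type*) [NormedAddCommGroup E] [NormedSpace ℝ E] :
    (E × (E →L[ℝ] ℝ)) →L[ℝ] (E × (E →L[ℝ] ℝ)) →L[ℝ] ℝ :=
  ((ContinuousLinearMap.compL ℝ (E × (E →L[ℝ] ℝ)) E ℝ).flip
    (ContinuousLinearMap.fst ℝ E (E →L[ℝ] ℝ))).comp (ContinuousLinearMap.snd ℝ E (E →L[ℝ] ℝ))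

@[simp]
theorem canonicalForm_apply (X Y : E × (E →L[ℝ] ℝ)) : canonicalForm E X Y = X.2 Y.1 := rfl

/-- The Liouville form read in the chart of the cotangent bundle at `p`. -/
noncomputable def liouvilleChart (p : Cotangent E M) (z : E × (E →L[ℝ] ℝ)) :
    (E × (E →L[ℝ] ℝ)) →L[ℝ] ℝ :=
  ContinuousLinearMap.comp
      (liouville E M ((extChartAt (IT E) p).symm z) : E × (E →L[ℝ] ℝ) →L[ℝ] ℝ)
      (mfderiv 𝓘(ℝ, E × (E →L[ℝ] ℝ)) (IT E) (extChartAt (IT E) p).symm z :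
        E × (E →L[ℝ] ℝ) →L[ℝ] E × (E →L[ℝ] ℝ))

/-- In a bundle chart of the cotangent bundle the Liouville form is `canonicalForm`: the fibre
coordinate of a covector is its coordinate expression in the chart of the base. -/
theorem liouville_chart (p : Cotangent E M) {z : E × (E →L[ℝ] ℝ)}
    (hz : z ∈ (extChartAt (IT E) p).target) :
    liouvilleChart p z = canonicalForm E z := by
  set φ := extChartAt (IT E) p with hφ
  set ψ := extChartAt 𝓘(ℝ, E) p.1 with hψ
  have hq : (φ.symm z).1 ∈ (chartAt E p.1).source := (mem_source_iff p _).1 (φ.map_target hz)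
  have hz1 : z.1 = ψ (φ.symm z).1 := congrArg Prod.fst (φ.right_inv hz).symm
  have hz2 : z.2 = ((φ.symm z).2 : E →L[ℝ] ℝ).comp
      (mfderiv 𝓘(ℝ, E) 𝓘(ℝ, E) ψ.symm (ψ (φ.symm z).1) : E →L[ℝ] E) :=
    (congrArg Prod.snd (φ.right_inv hz).symm).trans (extChartAt_cotangent_snd p _ hq)
  have hz1t : z.1 ∈ ψ.target := by
    rw [hz1]; exact ψ.map_source (by rwa [hψ, extChartAt_source])
  have hφd : MDifferentiableAt 𝓘(ℝ, E × (E →L[ℝ] ℝ)) (IT E) φ.symm z :=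
    ((contMDiffOn_extChartAt_symm (I := IT E) (n := ∞) p).contMDiffAt
      ((isOpen_extChartAt_target p).mem_nhds hz)).mdifferentiableAt (by simp)
  have hψd : MDifferentiableAt 𝓘(ℝ, E) 𝓘(ℝ, E) ψ.symm z.1 :=
    ((contMDiffOn_extChartAt_symm (I := 𝓘(ℝ, E)) (n := ∞) p.1).contMDiffAt
      ((isOpen_extChartAt_target p.1).mem_nhds hz1t)).mdifferentiableAt (by simp)
  have hπ : MDifferentiableAt (IT E) 𝓘(ℝ, E) (fun q : Cotangent E M => q.1) (φ.symm z) :=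
    (contMDiff_proj _).mdifferentiableAt (by simp)
  have h1 := mfderiv_comp z hπ hφd
  have h2 := mfderiv_comp (I := 𝓘(ℝ, E × (E →L[ℝ] ℝ))) z hψd
    (differentiableAt_fst.mdifferentiableAt (x := z))
  have h3 : mfderiv 𝓘(ℝ, E × (E →L[ℝ] ℝ)) 𝓘(ℝ, E) (Prod.fst : E × (E →L[ℝ] ℝ) → E) z =
      ContinuousLinearMap.fst ℝ E (E →L[ℝ] ℝ) :=
    mfderiv_eq_fderiv.trans fderiv_fst
  have h4 : ((fun q : Cotangent E M => q.1) ∘ φ.symm) =ᶠ[𝓝 z] ψ.symm ∘ Prod.fst := by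
    filter_upwards [(isOpen_extChartAt_target p).mem_nhds hz] with y hy
    have h5 : y.1 = ψ (φ.symm y).1 := congrArg Prod.fst (φ.right_inv hy).symm
    have h6 : (φ.symm y).1 ∈ ψ.source := by
      rw [hψ, extChartAt_source]; exact (mem_source_iff p _).1 (φ.map_target hy)
    simp only [Function.comp, h5, ψ.left_inv h6]
  have h5 := h4.mfderiv_eq (I := 𝓘(ℝ, E × (E →L[ℝ] ℝ))) (I' := 𝓘(ℝ, E))
  have h6 := (h1.symm.trans h5).trans h2
  refine ContinuousLinearMap.ext fun Y => ?_
  have h7 : (mfderiv (IT E) 𝓘(ℝ, E) (fun q : Cotangent E M => q.1) (φ.symm z) : _ →L[ℝ] E)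
      (mfderiv 𝓘(ℝ, E × (E →L[ℝ] ℝ)) (IT E) φ.symm z Y) =
        (mfderiv 𝓘(ℝ, E) 𝓘(ℝ, E) ψ.symm z.1 : E →L[ℝ] E) Y.1 :=
    (DFunLike.congr_fun h6 Y).trans
      (congrArg (mfderiv 𝓘(ℝ, E) 𝓘(ℝ, E) ψ.symm z.1 : E →L[ℝ] E) (DFunLike.congr_fun h3 Y))
  have h8 : z.2 Y.1 = ((φ.symm z).2 : E →L[ℝ] ℝ)
      ((mfderiv 𝓘(ℝ, E) 𝓘(ℝ, E) ψ.symm z.1 : E →L[ℝ] E) Y.1) := by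
    rw [hz1]
    exact DFunLike.congr_fun hz2 Y.1
  exact (congrArg ((φ.symm z).2 : E →L[ℝ] ℝ) h7).trans h8.symm

/-- The standard symplectic form `((q, v), (q', v')) ↦ v q' - v' q`. -/
noncomputable def symplecticForm (E : Type*) [NormedAddCommGroup E] [NormedSpace ℝ E] :
    LinearMap.BilinForm ℝ (E × (E →L[ℝ] ℝ)) :=
  LinearMap.mk₂ ℝ (fun X Y => X.2 Y.1 - Y.2 X.1) (fun X X' Y => by simp; ring)
    (fun c X Y => by simp; ring) (fun X Y Y' => by simp; ring) (fun c X Y => by simp; ring)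

theorem symplecticForm_apply (X Y : E × (E →L[ℝ] ℝ)) :
    symplecticForm E X Y = X.2 Y.1 - Y.2 X.1 := rfl

/-- `ω = ∑ dv_j ∧ du^j` in canonical coordinates. -/
theorem omega_eq (p : Cotangent E M) (X Y : E × (E →L[ℝ] ℝ)) :
    omega E M p X Y = symplecticForm E X Y := by
  refine (extDerivOneForm_eq (IT E) (liouville E M) p (canonicalForm E) ?_ X Y).trans ?_
  · filter_upwards [extChartAt_target_mem_nhds (I := IT E) p] with z hz
    exact liouville_chart p hz
  · rw [canonicalForm_apply, canonicalForm_apply, symplecticForm_apply]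

theorem symplecticForm_swap (X Y : E × (E →L[ℝ] ℝ)) :
    symplecticForm E Y X = -symplecticForm E X Y := by
  simp [symplecticForm_apply]

theorem isRefl_symplecticForm : (symplecticForm E).IsRefl := fun X Y h => by
  rw [symplecticForm_swap, h, neg_zero]

theorem eq_zero_of_symplecticForm_eq_zero {X : E × (E →L[ℝ] ℝ)}
    (hX : ∀ Y, symplecticForm E X Y = 0) : X = 0 := by
  have h1 : X.2 = 0 := ContinuousLinearMap.ext fun q => by
    simpa [symplecticForm_apply] using hX (q, 0)
  have h2 : X.1 = 0 := by
    by_contra h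
    obtain ⟨v, -, hv⟩ := exists_dual_vector ℝ X.1 (norm_ne_zero_iff.2 h)
    have h3 := hX (0, v)
    simp [symplecticForm_apply, hv, h] at h3
  exact Prod.ext h2 h1

theorem nondegenerate_symplecticForm : (symplecticForm E).Nondegenerate :=
  ⟨fun _ hX => eq_zero_of_symplecticForm_eq_zero hX,
    fun _ hX => eq_zero_of_symplecticForm_eq_zero fun Y => isRefl_symplecticForm _ _ (hX Y)⟩

end Coordinates

/-! ### Smoothness of the lifted action and of the momentum map -/

section Smoothness

variable {E : Type*} [NormedAddCommGroup E] [NormedSpace ℝ E]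
  {M : Type*} [TopologicalSpace M] [ChartedSpace E M] [IsManifold 𝓘(ℝ, E) ∞ M]

/-- The covector part of a point of the cotangent bundle, as a linear form on the model space. -/
def covector (p : Cotangent E M) : E →L[ℝ] ℝ := p.2

theorem inCoordinates_covector (u₀ u : M) (v : E →L[ℝ] ℝ) :
    ContinuousLinearMap.inCoordinates E (TangentSpace 𝓘(ℝ, E)) ℝ (Bundle.Trivial M ℝ)
      u₀ u u₀ u (v : TangentSpace 𝓘(ℝ, E) u →L[ℝ] ℝ) = v.comp
        ((trivializationAt E (TangentSpace 𝓘(ℝ, E)) u₀).symmL ℝ u : E →L[ℝ] E) :=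
  congrArg (fun A : ℝ →L[ℝ] ℝ => A.comp (v.comp
    ((trivializationAt E (TangentSpace 𝓘(ℝ, E)) u₀).symmL ℝ u : E →L[ℝ] E)))
      (Bundle.Trivial.continuousLinearMapAt_trivialization ℝ M ℝ u)

/-- The composition of a covector and a linear map between tangent spaces depends smoothly on
parameters if both do. -/
theorem contMDiffAt_covector_comp {EN HN : Type*} [NormedAddCommGroup EN] [NormedSpace ℝ EN]
    [TopologicalSpace HN] {IN : ModelWithCorners ℝ EN HN} {N : Type*} [TopologicalSpace N]
    [ChartedSpace HN N] {E' : Type*} [NormedAddCommGroup E'] [NormedSpace ℝ E'] {M' : Type*}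
    [TopologicalSpace M'] [ChartedSpace E' M'] [IsManifold 𝓘(ℝ, E') ∞ M'] {x₀ : N} {b : N → M'}
    {c : N → Cotangent E M} {A : N → E' →L[ℝ] E}
    (hA : ContMDiffAt IN 𝓘(ℝ, E' →L[ℝ] E) ∞
      (inTangentCoordinates 𝓘(ℝ, E') 𝓘(ℝ, E) b (fun x => (c x).1) A x₀) x₀)
    (hc : ContMDiffAt IN (IT E) ∞ c x₀) :
    ContMDiffAt IN 𝓘(ℝ, E' →L[ℝ] ℝ) ∞ (fun x => ((covector (c x)).comp (A x)).comp
      ((trivializationAt E' (TangentSpace 𝓘(ℝ, E')) (b x₀)).symmL ℝ (b x) : E' →L[ℝ] E')) x₀ := by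
  have hc' := (contMDiffAt_hom_bundle c).1 hc
  refine (hc'.2.clm_comp hA).congr_of_eventuallyEq ?_
  have h1 : ∀ᶠ x in 𝓝 x₀, (c x).1 ∈
      (trivializationAt E (TangentSpace 𝓘(ℝ, E)) (c x₀).1).baseSet :=
    hc'.1.continuousAt ((trivializationAt E (TangentSpace 𝓘(ℝ, E)) _).open_baseSet.mem_nhds
      (FiberBundle.mem_baseSet_trivializationAt' _))
  filter_upwards [h1] with x hx
  refine Eq.trans ?_ (congrArg (fun B : E →L[ℝ] ℝ => B.comp
    (inTangentCoordinates 𝓘(ℝ, E') 𝓘(ℝ, E) b (fun x => (c x).1) A x₀ x))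
      (inCoordinates_covector (c x₀).1 (c x).1 (covector (c x))).symm)
  refine ContinuousLinearMap.ext fun w => ?_
  exact (congrArg (covector (c x))
    (Bundle.Trivialization.symmL_continuousLinearMapAt _ hx _)).symm

variable {EG : Type*} [NormedAddCommGroup EG] [NormedSpace ℝ EG]
  {G : Type*} [TopologicalSpace G] [ChartedSpace EG G] [Group G] [LieGroup 𝓘(ℝ, EG) ∞ G]
  [MulAction G M] [ContMDiffSMul 𝓘(ℝ, EG) 𝓘(ℝ, E) ∞ G M]

/-- The cotangent lift of a smooth action is a smooth action. -/
theorem contMDiff_lift : ContMDiff (𝓘(ℝ, EG).prod (IT E)) (IT E) ∞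
    (fun x : G × Cotangent E M => lift x.1 x.2) := by
  intro x₀
  have hs := ContMDiffSMul.contMDiff_smul (I := 𝓘(ℝ, EG)) (I' := 𝓘(ℝ, E)) (n := ∞) (G := G) (M := M)
  have hb : ContMDiff (𝓘(ℝ, EG).prod (IT E)) 𝓘(ℝ, E) ∞
      (fun x : G × Cotangent E M => x.1 • x.2.1) :=
    hs.comp (contMDiff_fst.prodMk (contMDiff_proj.comp contMDiff_snd))
  have hf : ContMDiff ((𝓘(ℝ, EG).prod (IT E)).prod 𝓘(ℝ, E)) 𝓘(ℝ, E) ∞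
      (Function.uncurry fun (x : G × Cotangent E M) (y : M) => x.1⁻¹ • y) :=
    hs.comp (((contMDiff_inv 𝓘(ℝ, EG) ∞).comp (contMDiff_fst.comp contMDiff_fst)).prodMk
      contMDiff_snd)
  refine (contMDiffAt_hom_bundle _).2 ⟨hb x₀, ?_⟩
  have h1 := ContMDiffAt.mfderiv (m := ∞) _ _ (hf _) (hb x₀) (by simp)
  have h2 : (fun x : G × Cotangent E M => x.1⁻¹ • x.1 • x.2.1) = fun x => x.2.1 := by
    ext x; exact inv_smul_smul _ _
  have h3 := (congrArg (fun k => ContMDiffAt (𝓘(ℝ, EG).prod (IT E)) 𝓘(ℝ, E →L[ℝ] E) ∞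
    (inTangentCoordinates 𝓘(ℝ, E) 𝓘(ℝ, E) (fun x : G × Cotangent E M => x.1 • x.2.1) k
      (fun x : G × Cotangent E M => (mfderiv 𝓘(ℝ, E) 𝓘(ℝ, E) (fun y : M => x.1⁻¹ • y)
        (x.1 • x.2.1) : E →L[ℝ] E)) x₀) x₀) h2).mp h1
  refine (contMDiffAt_covector_comp h3 contMDiffAt_snd).congr_of_eventuallyEq
    (Filter.Eventually.of_forall fun x => ?_)
  exact inCoordinates_covector _ _ _

theorem contMDiff_lift_left {EG : Type*} [NormedAddCommGroup EG] [NormedSpace ℝ EG] {G : Type*}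
    [TopologicalSpace G] [ChartedSpace EG G] [Group G] [LieGroup 𝓘(ℝ, EG) ∞ G] [MulAction G M]
    [ContMDiffSMul 𝓘(ℝ, EG) 𝓘(ℝ, E) ∞ G M] (g : G) :
    ContMDiff (IT E) (IT E) ∞ (fun p : Cotangent E M => lift g p) :=
  (contMDiff_lift (EG := EG)).comp ((contMDiff_const (c := g)).prodMk contMDiff_id)

theorem contMDiff_lift_right (p : Cotangent E M) :
    ContMDiff 𝓘(ℝ, EG) (IT E) ∞ (fun g : G => lift g p) :=
  contMDiff_lift.comp (contMDiff_id.prodMk (contMDiff_const (c := p)))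

/-- The momentum map is smooth. -/
theorem contMDiff_momentum : ContMDiff (IT E) 𝓘(ℝ, EG →L[ℝ] ℝ) ∞
    (show Cotangent E M → (EG →L[ℝ] ℝ) from momentum (EG := EG) (G := G)) := by
  intro p₀
  have hs := ContMDiffSMul.contMDiff_smul (I := 𝓘(ℝ, EG)) (I' := 𝓘(ℝ, E)) (n := ∞) (G := G) (M := M)
  have hf : ContMDiff ((IT E).prod 𝓘(ℝ, EG)) 𝓘(ℝ, E) ∞
      (Function.uncurry fun (p : Cotangent E M) (g : G) => g • p.1) :=
    hs.comp (contMDiff_snd.prodMk (contMDiff_proj.comp contMDiff_fst))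
  have h1 := ContMDiffAt.mfderiv (m := ∞) (x₀ := p₀) _ (fun _ => (1 : G)) (hf _) contMDiffAt_const
    (by simp)
  have h2 : (fun p : Cotangent E M => (1 : G) • p.1) = fun p => p.1 := by
    ext p; exact one_smul _ _
  have h3 := (congrArg (fun k => ContMDiffAt (IT E) 𝓘(ℝ, EG →L[ℝ] E) ∞
    (inTangentCoordinates 𝓘(ℝ, EG) 𝓘(ℝ, E) (fun _ : Cotangent E M => (1 : G)) k
      (fun p : Cotangent E M => (mfderiv 𝓘(ℝ, EG) 𝓘(ℝ, E) (fun g : G => g • p.1) 1 :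
        EG →L[ℝ] E)) p₀) p₀) h2).mp h1
  have h4 : ((trivializationAt EG (TangentSpace 𝓘(ℝ, EG)) (1 : G)).symmL ℝ 1 : EG →L[ℝ] EG) =
      ContinuousLinearMap.id ℝ EG := by
    refine (TangentBundle.symmL_trivializationAt (mem_chart_source EG (1 : G))).trans ?_
    exact mfderivWithin_range_extChartAt_symm
  refine (contMDiffAt_covector_comp h3 contMDiffAt_id).congr_of_eventuallyEq
    (Filter.Eventually.of_forall fun p => ?_)
  refine ContinuousLinearMap.ext fun a => ?_
  exact congrArg (((covector p).comp (mfderiv 𝓘(ℝ, EG) 𝓘(ℝ, E)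
    (fun g : G => g • p.1) 1 : EG →L[ℝ] E))) (DFunLike.congr_fun h4 a).symm

end Smoothness

/-! ### Pullbacks of the Liouville form -/

section Pullback

variable {E : Type*} [NormedAddCommGroup E] [NormedSpace ℝ E]
  {M : Type*} [TopologicalSpace M] [ChartedSpace E M] [IsManifold 𝓘(ℝ, E) ∞ M]
  {Z : Type*} [NormedAddCommGroup Z] [NormedSpace ℝ Z]

/-- The pullback of the Liouville form along a map from a vector space to the cotangent bundle,
computed in the chart at `p`. -/
noncomputable def liouvillePullback (f : Z → Cotangent E M) (p : Cotangent E M) (z : Z) :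
    Z →L[ℝ] ℝ :=
  (canonicalForm E (extChartAt (IT E) p (f z))).comp
    (fderiv ℝ (fun y => (extChartAt (IT E) p (f y) : E × (E →L[ℝ] ℝ))) z)

theorem mfderiv_eq_fderiv_extChartAt {F H : Type*} [NormedAddCommGroup F] [NormedSpace ℝ F]
    [TopologicalSpace H] {I : ModelWithCorners ℝ F H} {N : Type*} [TopologicalSpace N]
    [ChartedSpace H N] {f : Z → N} {z : Z} (hf : MDifferentiableAt 𝓘(ℝ, Z) I f z) :
    (mfderiv 𝓘(ℝ, Z) I f z : Z →L[ℝ] F) = fderiv ℝ (fun y => extChartAt I (f z) (f y)) z := by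
  refine hf.mfderiv.trans ?_
  simp only [mfld_simps, fderivWithin_univ]
  rfl

theorem liouvillePullback_apply {f : Z → Cotangent E M} {p : Cotangent E M} {z : Z}
    (hf : MDifferentiableAt 𝓘(ℝ, Z) (IT E) f z) (hz : f z ∈ (extChartAt (IT E) p).source) (Y : Z) :
    liouvillePullback f p z Y =
      liouville E M (f z) ((mfderiv 𝓘(ℝ, Z) (IT E) f z : Z →L[ℝ] E × (E →L[ℝ] ℝ)) Y) := by
  set φ := extChartAt (IT E) p with hφ
  have hφd : MDifferentiableAt (IT E) 𝓘(ℝ, E × (E →L[ℝ] ℝ)) φ (f z) :=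
    mdifferentiableAt_extChartAt (by rwa [hφ, extChartAt_source] at hz)
  have hφs : MDifferentiableAt 𝓘(ℝ, E × (E →L[ℝ] ℝ)) (IT E) φ.symm (φ (f z)) :=
    ((contMDiffOn_extChartAt_symm (I := IT E) (n := ∞) p).contMDiffAt
      ((isOpen_extChartAt_target p).mem_nhds (φ.map_source hz))).mdifferentiableAt (by simp)
  have h1 : mfderiv 𝓘(ℝ, Z) 𝓘(ℝ, E × (E →L[ℝ] ℝ)) (φ ∘ f) z = fderiv ℝ (φ ∘ f) z :=
    mfderiv_eq_fderiv
  have h2 := mfderiv_comp z (g := φ.symm) (f := φ ∘ f) hφs (hφd.comp z hf)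
  have h3 : φ.symm ∘ φ ∘ f =ᶠ[𝓝 z] f := by
    filter_upwards [hf.continuousAt ((isOpen_extChartAt_source p).mem_nhds hz)] with y hy
    exact φ.left_inv hy
  have h4 := h3.mfderiv_eq (I := 𝓘(ℝ, Z)) (I' := IT E)
  have h5 : (mfderiv 𝓘(ℝ, E × (E →L[ℝ] ℝ)) (IT E) φ.symm (φ (f z)) :
      E × (E →L[ℝ] ℝ) →L[ℝ] E × (E →L[ℝ] ℝ)) (fderiv ℝ (φ ∘ f) z Y) =
      (mfderiv 𝓘(ℝ, Z) (IT E) f z : Z →L[ℝ] E × (E →L[ℝ] ℝ)) Y := by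
    refine Eq.trans ?_ (DFunLike.congr_fun (h2.symm.trans h4) Y)
    exact congrArg (mfderiv 𝓘(ℝ, E × (E →L[ℝ] ℝ)) (IT E) φ.symm (φ (f z)) :
      E × (E →L[ℝ] ℝ) →L[ℝ] E × (E →L[ℝ] ℝ)) (DFunLike.congr_fun h1 Y).symm
  have h6 := DFunLike.congr_fun (liouville_chart p (φ.map_source hz)) (fderiv ℝ (φ ∘ f) z Y)
  refine h6.symm.trans ?_
  refine (congrArg (liouville E M (φ.symm (φ (f z))) : E × (E →L[ℝ] ℝ) →L[ℝ] ℝ) h5).trans ?_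
  rw [φ.left_inv hz]

theorem eventually_liouvillePullback_apply {f : Z → Cotangent E M} {z : Z}
    (hf : ContMDiffAt 𝓘(ℝ, Z) (IT E) ∞ f z) :
    ∀ᶠ y in 𝓝 z, ∀ Y, liouvillePullback f (f z) y Y =
      liouville E M (f y) (mfderiv 𝓘(ℝ, Z) (IT E) f y Y) := by
  have h1 : ∀ᶠ y in 𝓝 z, ContMDiffAt 𝓘(ℝ, Z) (IT E) 1 f y :=
    (contMDiffAt_iff_contMDiffAt_nhds (by simp)).1 (hf.of_le (by norm_cast))
  filter_upwards [h1, hf.continuousAt (extChartAt_source_mem_nhds (I := IT E) (f z))] with y hy hy'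
  exact liouvillePullback_apply (hy.mdifferentiableAt (by simp)) hy'

theorem contDiffAt_chart_comp {f : Z → Cotangent E M} {z : Z}
    (hf : ContMDiffAt 𝓘(ℝ, Z) (IT E) ∞ f z) :
    ContDiffAt ℝ ∞ (fun y => (extChartAt (IT E) (f z) (f y) : E × (E →L[ℝ] ℝ))) z :=
  (((contMDiffAt_extChartAt (I := IT E) (n := ∞) (x := f z)).comp z hf)).contDiffAt

theorem differentiableAt_liouvillePullback {f : Z → Cotangent E M} {z : Z}
    (hf : ContMDiffAt 𝓘(ℝ, Z) (IT E) ∞ f z) :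
    DifferentiableAt ℝ (liouvillePullback f (f z)) z := by
  exact differentiableAt_pullback (canonicalForm E)
    ((contDiffAt_chart_comp hf).of_le (by norm_cast))

/-- The exterior derivative of the pullback of the Liouville form is the pullback of `ω`, whose
coordinate expression is `(X, Y) ↦ canonicalForm E X Y - canonicalForm E Y X`. -/
theorem fderiv_liouvillePullback_sub {f : Z → Cotangent E M} {z : Z}
    (hf : ContMDiffAt 𝓘(ℝ, Z) (IT E) ∞ f z) {D : Z → E × (E →L[ℝ] ℝ)}
    (hD : ∀ W : Z, (mfderiv 𝓘(ℝ, Z) (IT E) f z : Z →L[ℝ] E × (E →L[ℝ] ℝ)) W = D W) (X Y : Z) :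
    fderiv ℝ (liouvillePullback f (f z)) z X Y - fderiv ℝ (liouvillePullback f (f z)) z Y X =
      canonicalForm E (D X) (D Y) - canonicalForm E (D Y) (D X) := by
  have h := contDiffAt_chart_comp hf
  have h1 := fderiv_pullback_sub (canonicalForm E) (h.of_le (by norm_cast)) X Y
  refine h1.trans ?_
  have h2 : ∀ W : Z,
      fderiv ℝ (fun y => (extChartAt (IT E) (f z) (f y) : E × (E →L[ℝ] ℝ))) z W = D W :=
    fun W => (DFunLike.congr_fun
      (mfderiv_eq_fderiv_extChartAt (hf.mdifferentiableAt (by simp))) W).symm.trans (hD W)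
  rw [h2, h2]

/-- If the pullback of the Liouville form is `y ↦ A y` near `z`, for a bilinear form `A`, then the
pullback of `ω` at `z` is `(X, Y) ↦ A X Y - A Y X`. -/
theorem canonicalForm_mfderiv_sub {f : Z → Cotangent E M} {z : Z}
    (hf : ContMDiffAt 𝓘(ℝ, Z) (IT E) ∞ f z) {D : Z → E × (E →L[ℝ] ℝ)}
    (hD : ∀ W : Z, (mfderiv 𝓘(ℝ, Z) (IT E) f z : Z →L[ℝ] E × (E →L[ℝ] ℝ)) W = D W)
    (A : Z →L[ℝ] Z →L[ℝ] ℝ)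
    (hA : ∀ᶠ y in 𝓝 z, ∀ Y, liouville E M (f y) (mfderiv 𝓘(ℝ, Z) (IT E) f y Y) = A y Y) (X Y : Z) :
    canonicalForm E (D X) (D Y) - canonicalForm E (D Y) (D X) = A X Y - A Y X := by
  have h : liouvillePullback f (f z) =ᶠ[𝓝 z] A := by
    filter_upwards [eventually_liouvillePullback_apply hf, hA] with y h1 h2
    exact ContinuousLinearMap.ext fun Y => (h1 Y).trans (h2 Y)
  rw [← fderiv_liouvillePullback_sub hf hD, fderiv_eq_of_eventuallyEq_clm h]

/-- The pullback of `ω` in terms of the derivatives of the pullback of the Liouville form along two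
straight lines. -/
theorem canonicalForm_mfderiv_sub_of_hasDerivAt {f : Z → Cotangent E M} {z : Z}
    (hf : ContMDiffAt 𝓘(ℝ, Z) (IT E) ∞ f z) {D : Z → E × (E →L[ℝ] ℝ)}
    (hD : ∀ W : Z, (mfderiv 𝓘(ℝ, Z) (IT E) f z : Z →L[ℝ] E × (E →L[ℝ] ℝ)) W = D W)
    {X Y : Z} {θX θY : ℝ → ℝ} {c d : ℝ}
    (hθY : ∀ᶠ t : ℝ in 𝓝 0, liouville E M (f (z + t • X))
      (mfderiv 𝓘(ℝ, Z) (IT E) f (z + t • X) Y) = θY t) (hc : HasDerivAt θY c 0)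
    (hθX : ∀ᶠ t : ℝ in 𝓝 0, liouville E M (f (z + t • Y))
      (mfderiv 𝓘(ℝ, Z) (IT E) f (z + t • Y) X) = θX t) (hd : HasDerivAt θX d 0) :
    canonicalForm E (D X) (D Y) - canonicalForm E (D Y) (D X) = c - d := by
  have h : ∀ V : Z, Filter.Tendsto (fun t : ℝ => z + t • V) (𝓝 0) (𝓝 z) := fun V =>
    Continuous.tendsto' (by fun_prop) _ _ (by simp)
  have hα := differentiableAt_liouvillePullback hf
  rw [← fderiv_liouvillePullback_sub hf hD, fderiv_apply_eq_of_hasDerivAt hα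
    (hc.congr_of_eventuallyEq _), fderiv_apply_eq_of_hasDerivAt hα (hd.congr_of_eventuallyEq _)]
  · filter_upwards [hθX, (h Y).eventually (eventually_liouvillePullback_apply hf)] with t h1 h2
    exact (h2 X).trans h1
  · filter_upwards [hθY, (h X).eventually (eventually_liouvillePullback_apply hf)] with t h1 h2
    exact (h2 Y).trans h1

end Pullback

/-! ### Invariance of the symplectic form under the lifted action -/

/-- The derivatives at two equal points agree as maps between the model spaces; their types, which
mention the points, differ. -/
theorem mfderiv_eq_of_point_eq {F H : Type*} [NormedAddCommGroup F] [NormedSpace ℝ F]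
    [TopologicalSpace H] {I : ModelWithCorners ℝ F H} {N : Type*} [TopologicalSpace N]
    [ChartedSpace H N] {F' H' : Type*} [NormedAddCommGroup F'] [NormedSpace ℝ F']
    [TopologicalSpace H'] {I' : ModelWithCorners ℝ F' H'} {N' : Type*} [TopologicalSpace N']
    [ChartedSpace H' N'] {f : N → N'} {x y : N} (h : x = y) :
    (mfderiv I I' f x : F →L[ℝ] F') = mfderiv I I' f y := by
  subst h; rfl

theorem mfderiv_extChartAt_symm_self {F H : Type*} [NormedAddCommGroup F] [NormedSpace ℝ F]
    [TopologicalSpace H] {I : ModelWithCorners ℝ F H} [I.Boundaryless] {N : Type*}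
    [TopologicalSpace N] [ChartedSpace H N] [IsManifold I 1 N] (x : N) :
    (mfderiv 𝓘(ℝ, F) I (extChartAt I x).symm (extChartAt I x x) : F →L[ℝ] F) =
      ContinuousLinearMap.id ℝ F := by
  have h := mfderivWithin_range_extChartAt_symm (I := I) (x := x)
  rw [I.range_eq_univ, mfderivWithin_univ] at h
  exact h

theorem contMDiffAt_extChartAt_symm {F H : Type*} [NormedAddCommGroup F] [NormedSpace ℝ F]
    [TopologicalSpace H] {I : ModelWithCorners ℝ F H} [I.Boundaryless] {N : Type*}
    [TopologicalSpace N] [ChartedSpace H N] [IsManifold I ∞ N] (x : N) {z : F}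
    (hz : z ∈ (extChartAt I x).target) :
    ContMDiffAt 𝓘(ℝ, F) I ∞ (extChartAt I x).symm z :=
  (contMDiffOn_extChartAt_symm (I := I) (n := ∞) x).contMDiffAt
      ((isOpen_extChartAt_target x).mem_nhds hz)

theorem mfderiv_apply_left {Z₁ Z₂ F H : Type*} [NormedAddCommGroup Z₁] [NormedSpace ℝ Z₁]
    [NormedAddCommGroup Z₂] [NormedSpace ℝ Z₂] [NormedAddCommGroup F] [NormedSpace ℝ F]
    [TopologicalSpace H] {I : ModelWithCorners ℝ F H} {N : Type*} [TopologicalSpace N]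
    [ChartedSpace H N] {f : Z₁ × Z₂ → N} {x : Z₁} {y : Z₂}
    (hf : MDifferentiableAt 𝓘(ℝ, Z₁ × Z₂) I f (x, y)) (a : Z₁) :
    (mfderiv 𝓘(ℝ, Z₁ × Z₂) I f (x, y) : Z₁ × Z₂ →L[ℝ] F) (a, 0) =
      (mfderiv 𝓘(ℝ, Z₁) I (fun x => f (x, y)) x : Z₁ →L[ℝ] F) a := by
  have h : HasFDerivAt (fun x : Z₁ => (x, y)) (ContinuousLinearMap.inl ℝ Z₁ Z₂) x :=
    (hasFDerivAt_id x).prodMk (hasFDerivAt_const y x)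
  exact (DFunLike.congr_fun (hf.hasMFDerivAt.comp x h.hasMFDerivAt).mfderiv a).symm

theorem mfderiv_apply_right {Z₁ Z₂ F H : Type*} [NormedAddCommGroup Z₁] [NormedSpace ℝ Z₁]
    [NormedAddCommGroup Z₂] [NormedSpace ℝ Z₂] [NormedAddCommGroup F] [NormedSpace ℝ F]
    [TopologicalSpace H] {I : ModelWithCorners ℝ F H} {N : Type*} [TopologicalSpace N]
    [ChartedSpace H N] {f : Z₁ × Z₂ → N} {x : Z₁} {y : Z₂}
    (hf : MDifferentiableAt 𝓘(ℝ, Z₁ × Z₂) I f (x, y)) (b : Z₂) :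
    (mfderiv 𝓘(ℝ, Z₁ × Z₂) I f (x, y) : Z₁ × Z₂ →L[ℝ] F) (0, b) =
      (mfderiv 𝓘(ℝ, Z₂) I (fun y => f (x, y)) y : Z₂ →L[ℝ] F) b := by
  have h : HasFDerivAt (fun y : Z₂ => (x, y)) (ContinuousLinearMap.inr ℝ Z₁ Z₂) y :=
    (hasFDerivAt_const x y).prodMk (hasFDerivAt_id y)
  exact (DFunLike.congr_fun (hf.hasMFDerivAt.comp y h.hasMFDerivAt).mfderiv b).symm

section Invariance

variable {E : Type*} [NormedAddCommGroup E] [NormedSpace ℝ E]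
  {M : Type*} [TopologicalSpace M] [ChartedSpace E M] [IsManifold 𝓘(ℝ, E) ∞ M]
  {EG : Type*} [NormedAddCommGroup EG] [NormedSpace ℝ EG]
  {G : Type*} [TopologicalSpace G] [ChartedSpace EG G] [Group G] [LieGroup 𝓘(ℝ, EG) ∞ G]
  [MulAction G M]

theorem liouville_congr {p q : Cotangent E M} (h : p = q) :
    (liouville E M p : E × (E →L[ℝ] ℝ) →L[ℝ] ℝ) = liouville E M q := by
  subst h; rfl

/-- The cotangent lift preserves the Liouville form. -/
theorem liouville_lift [ContMDiffSMul 𝓘(ℝ, EG) 𝓘(ℝ, E) ∞ G M]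
    (g : G) (p : Cotangent E M) (X : TangentSpace (IT E) p) :
    liouville E M (lift g p) (mfderiv (IT E) (IT E) (fun q : Cotangent E M => lift g q) p X) =
      liouville E M p X := by
  have hL : MDifferentiableAt (IT E) (IT E) (fun q : Cotangent E M => lift g q) p :=
    (contMDiff_lift_left (EG := EG) g).mdifferentiableAt (by simp)
  have hπ : ∀ q : Cotangent E M,
      MDifferentiableAt (IT E) 𝓘(ℝ, E) (fun q : Cotangent E M => q.1) q :=
    fun q => contMDiff_proj.mdifferentiableAt (by simp)
  have h1 := mfderiv_comp p (hπ (lift g p)) hL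
  have h2 := mfderiv_comp p (mdifferentiable_smul EG (E := E) g p.1) (hπ p)
  have h3 := mfderiv_comp p.1 (mdifferentiable_smul EG (E := E) g⁻¹ (g • p.1))
    (mdifferentiable_smul EG (E := E) g p.1)
  have h4 : ((fun y : M => g⁻¹ • y) ∘ fun y : M => g • y) = id := by
    ext y; simp
  have h5 : (mfderiv 𝓘(ℝ, E) 𝓘(ℝ, E) ((fun y : M => g⁻¹ • y) ∘ fun y : M => g • y) p.1 :
      E →L[ℝ] E) = ContinuousLinearMap.id ℝ E :=
    (mfderiv_eq_of_eq h4 rfl).trans mfderiv_id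
  have h6 := DFunLike.congr_fun (h1.symm.trans h2) X
  have h7 := DFunLike.congr_fun (h3.symm.trans h5)
    (mfderiv (IT E) 𝓘(ℝ, E) (fun q : Cotangent E M => q.1) p X)
  refine congrArg (covector p) (Eq.trans ?_ h7)
  exact congrArg (mfderiv 𝓘(ℝ, E) 𝓘(ℝ, E) (fun y : M => g⁻¹ • y) (g • p.1) : E →L[ℝ] E) h6

/-- The momentum map is the contraction of the Liouville form with the generators. -/
theorem liouville_generator [ContMDiffSMul 𝓘(ℝ, EG) 𝓘(ℝ, E) ∞ G M]
    (p : Cotangent E M) (a : EG) :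
    liouville E M p (generator (EG := EG) (G := G) p a) = momentum (EG := EG) (G := G) p a := by
  have hO : MDifferentiableAt 𝓘(ℝ, EG) (IT E) (fun g : G => lift g p) 1 :=
    (contMDiff_lift_right p).mdifferentiableAt (by simp)
  have hπ : MDifferentiableAt (IT E) 𝓘(ℝ, E) (fun q : Cotangent E M => q.1) (lift (1 : G) p) :=
    contMDiff_proj.mdifferentiableAt (by simp)
  have h1 := DFunLike.congr_fun (mfderiv_comp (1 : G) hπ hO) a
  have h2 : (mfderiv (IT E) 𝓘(ℝ, E) (fun q : Cotangent E M => q.1) (lift (1 : G) p) :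
      E × (E →L[ℝ] ℝ) →L[ℝ] E) = mfderiv (IT E) 𝓘(ℝ, E) (fun q : Cotangent E M => q.1) p :=
    mfderiv_eq_of_point_eq (lift_one p)
  refine congrArg (covector p) (Eq.trans ?_ h1.symm)
  exact (DFunLike.congr_fun h2 _).symm

/-- Read in a chart, the lift of `g` pulls the Liouville form back to the canonical form, whatever
`g` is. -/
theorem liouville_lift_chart [ContMDiffSMul 𝓘(ℝ, EG) 𝓘(ℝ, E) ∞ G M]
    (g : G) (p : Cotangent E M) {z : E × (E →L[ℝ] ℝ)}
    (hz : z ∈ (extChartAt (IT E) p).target) (Y : E × (E →L[ℝ] ℝ)) :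
    liouville E M (lift g ((extChartAt (IT E) p).symm z))
      (mfderiv 𝓘(ℝ, E × (E →L[ℝ] ℝ)) (IT E) (fun y => lift g ((extChartAt (IT E) p).symm y)) z Y) =
        canonicalForm E z Y := by
  have hφ := (contMDiffAt_extChartAt_symm (I := IT E) p hz).mdifferentiableAt (by simp)
  have hL : MDifferentiableAt (IT E) (IT E) (fun q : Cotangent E M => lift g q)
      ((extChartAt (IT E) p).symm z) :=
    (contMDiff_lift_left (EG := EG) g).mdifferentiableAt (by simp)
  have h1 := DFunLike.congr_fun (mfderiv_comp z hL hφ) Y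
  refine (congrArg (liouville E M (lift g ((extChartAt (IT E) p).symm z))) h1).trans ?_
  refine (liouville_lift (EG := EG) g _ _).trans ?_
  exact DFunLike.congr_fun (liouville_chart p hz) Y

/-- The cotangent lift preserves `ω`. -/
theorem omega_lift [ContMDiffSMul 𝓘(ℝ, EG) 𝓘(ℝ, E) ∞ G M]
    (g : G) (p : Cotangent E M) (X Y : TangentSpace (IT E) p) :
    omega E M (lift g p) (mfderiv (IT E) (IT E) (fun q : Cotangent E M => lift g q) p X)
      (mfderiv (IT E) (IT E) (fun q : Cotangent E M => lift g q) p Y) = omega E M p X Y := by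
  set φ := extChartAt (IT E) p with hφ
  have hz : φ p ∈ φ.target := mem_extChartAt_target p
  have hs := contMDiffAt_extChartAt_symm (I := IT E) p hz
  have hf : ContMDiffAt 𝓘(ℝ, E × (E →L[ℝ] ℝ)) (IT E) ∞ (fun y => lift g (φ.symm y)) (φ p) :=
    (contMDiff_lift_left (EG := EG) g).contMDiffAt.comp (φ p) hs
  have hL : MDifferentiableAt (IT E) (IT E) (fun q : Cotangent E M => lift g q) (φ.symm (φ p)) :=
    (contMDiff_lift_left (EG := EG) g).mdifferentiableAt (by simp)
  have hp : (mfderiv (IT E) (IT E) (fun q : Cotangent E M => lift g q) (φ.symm (φ p)) :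
      E × (E →L[ℝ] ℝ) →L[ℝ] E × (E →L[ℝ] ℝ)) =
        mfderiv (IT E) (IT E) (fun q : Cotangent E M => lift g q) p :=
    mfderiv_eq_of_point_eq (φ.left_inv (mem_extChartAt_source p))
  have hD : ∀ W : E × (E →L[ℝ] ℝ),
      (mfderiv 𝓘(ℝ, E × (E →L[ℝ] ℝ)) (IT E) (fun y => lift g (φ.symm y)) (φ p) :
        E × (E →L[ℝ] ℝ) →L[ℝ] E × (E →L[ℝ] ℝ)) W =
      (mfderiv (IT E) (IT E) (fun q : Cotangent E M => lift g q) p :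
        E × (E →L[ℝ] ℝ) →L[ℝ] E × (E →L[ℝ] ℝ)) W := by
    intro W
    refine (DFunLike.congr_fun (mfderiv_comp (φ p) hL (hs.mdifferentiableAt (by simp))) W).trans ?_
    refine (congrArg (mfderiv (IT E) (IT E) (fun q : Cotangent E M => lift g q) (φ.symm (φ p)) :
      E × (E →L[ℝ] ℝ) →L[ℝ] E × (E →L[ℝ] ℝ))
        (DFunLike.congr_fun (mfderiv_extChartAt_symm_self (I := IT E) p) W)).trans ?_
    exact DFunLike.congr_fun hp W
  have h1 := canonicalForm_mfderiv_sub hf hD (canonicalForm E)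
    (by filter_upwards [extChartAt_target_mem_nhds (I := IT E) p] with y hy
        exact liouville_lift_chart (EG := EG) g p hy)
  exact (omega_eq _ _ _).trans ((h1 X Y).trans (omega_eq _ _ _).symm)

end Invariance

/-! ### The Hamiltonian property of the momentum map -/

section MomentumForm

variable {E : Type*} [NormedAddCommGroup E] [NormedSpace ℝ E]
  {M : Type*} [TopologicalSpace M] [ChartedSpace E M] [IsManifold 𝓘(ℝ, E) ∞ M]
  {EG : Type*} [NormedAddCommGroup EG] [NormedSpace ℝ EG]
  {G : Type*} [TopologicalSpace G] [ChartedSpace EG G] [Group G] [LieGroup 𝓘(ℝ, EG) ∞ G]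
  [MulAction G M]

/-- The momentum map, with the dual of the Lie algebra as a space of linear forms on the model
space of the group. -/
noncomputable def momentumMap (E M EG G : Type*) [NormedAddCommGroup E] [NormedSpace ℝ E]
    [TopologicalSpace M] [ChartedSpace E M] [IsManifold 𝓘(ℝ, E) ∞ M] [NormedAddCommGroup EG]
    [NormedSpace ℝ EG] [TopologicalSpace G] [ChartedSpace EG G] [Group G] [MulAction G M]
    (p : Cotangent E M) : EG →L[ℝ] ℝ := momentum (EG := EG) (G := G) p

/-- The derivative of the momentum map. -/
noncomputable def momentumDeriv (E M EG G : Type*) [NormedAddCommGroup E] [NormedSpace ℝ E]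
    [TopologicalSpace M] [ChartedSpace E M] [IsManifold 𝓘(ℝ, E) ∞ M] [NormedAddCommGroup EG]
    [NormedSpace ℝ EG] [TopologicalSpace G] [ChartedSpace EG G] [Group G] [MulAction G M]
    (p : Cotangent E M) : (E × (E →L[ℝ] ℝ)) →L[ℝ] EG →L[ℝ] ℝ :=
  mfderiv (IT E) 𝓘(ℝ, EG →L[ℝ] ℝ) (momentumMap E M EG G) p

/-- The infinitesimal generators at `p`, as a linear map between the model spaces. -/
noncomputable def generatorMap {E M : Type*} (EG G : Type*) [NormedAddCommGroup E]
    [NormedSpace ℝ E] [TopologicalSpace M] [ChartedSpace E M] [IsManifold 𝓘(ℝ, E) ∞ M]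
    [NormedAddCommGroup EG] [NormedSpace ℝ EG] [TopologicalSpace G] [ChartedSpace EG G] [Group G]
    [MulAction G M] (p : Cotangent E M) : EG →L[ℝ] E × (E →L[ℝ] ℝ) :=
  generator (EG := EG) (G := G) p

theorem contMDiff_momentumMap [ContMDiffSMul 𝓘(ℝ, EG) 𝓘(ℝ, E) ∞ G M] :
    ContMDiff (IT E) 𝓘(ℝ, EG →L[ℝ] ℝ) ∞ (momentumMap E M EG G) :=
  contMDiff_momentum

/-- The derivative of the momentum map in the chart at `p`. -/
theorem hasFDerivAt_momentumMap_chart [ContMDiffSMul 𝓘(ℝ, EG) 𝓘(ℝ, E) ∞ G M]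
    (p : Cotangent E M) :
    HasFDerivAt (fun z => momentumMap E M EG G ((extChartAt (IT E) p).symm z))
      (momentumDeriv E M EG G p) (extChartAt (IT E) p p) := by
  set φ := extChartAt (IT E) p with hφ
  have hs := (contMDiffAt_extChartAt_symm (I := IT E) p
    (mem_extChartAt_target p)).mdifferentiableAt (by simp)
  have hm : MDifferentiableAt (IT E) 𝓘(ℝ, EG →L[ℝ] ℝ) (momentumMap E M EG G) (φ.symm (φ p)) :=
    contMDiff_momentumMap.mdifferentiableAt (by simp)
  have hp : (mfderiv (IT E) 𝓘(ℝ, EG →L[ℝ] ℝ) (momentumMap E M EG G) (φ.symm (φ p)) :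
      E × (E →L[ℝ] ℝ) →L[ℝ] EG →L[ℝ] ℝ) = momentumDeriv E M EG G p :=
    mfderiv_eq_of_point_eq (φ.left_inv (mem_extChartAt_source p))
  have h1 := (hm.comp (φ p) hs).differentiableAt.hasFDerivAt
  have h2 : fderiv ℝ (momentumMap E M EG G ∘ φ.symm) (φ p) = momentumDeriv E M EG G p := by
    refine mfderiv_eq_fderiv.symm.trans ((mfderiv_comp (φ p) hm hs).trans ?_)
    refine ContinuousLinearMap.ext fun W => ?_
    refine (congrArg (mfderiv (IT E) 𝓘(ℝ, EG →L[ℝ] ℝ) (momentumMap E M EG G) (φ.symm (φ p)) :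
      E × (E →L[ℝ] ℝ) →L[ℝ] EG →L[ℝ] ℝ)
        (DFunLike.congr_fun (mfderiv_extChartAt_symm_self (I := IT E) p) W)).trans ?_
    exact DFunLike.congr_fun hp W
  rw [h2] at h1
  exact h1

/-- The defining property of the momentum map: `i_{K_a} ω = -d⟨l, a⟩`. The action on the cotangent
bundle, read in charts as a map of both variables, pulls the Liouville form back to a form whose
restriction to the cotangent directions does not depend on the group element, and whose value on the
group direction `a` at the unit is `⟨l, a⟩`. -/
theorem omega_generator [ContMDiffSMul 𝓘(ℝ, EG) 𝓘(ℝ, E) ∞ G M] (p : Cotangent E M) (a : EG)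
    (Y : E × (E →L[ℝ] ℝ)) :
    symplecticForm E (generatorMap EG G p a) Y = -momentumDeriv E M EG G p Y a := by
  set φ := extChartAt (IT E) p with hφ
  set χ := extChartAt 𝓘(ℝ, EG) (1 : G) with hχ
  set f : EG × (E × (E →L[ℝ] ℝ)) → Cotangent E M := fun ζ => lift (χ.symm ζ.1) (φ.symm ζ.2) with hf
  have hφp : φ.symm (φ p) = p := φ.left_inv (mem_extChartAt_source p)
  have hχ1 : χ.symm (χ 1) = 1 := χ.left_inv (mem_extChartAt_source 1)
  have hχs := contMDiffAt_extChartAt_symm (I := 𝓘(ℝ, EG)) (1 : G) (mem_extChartAt_target 1)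
  -- Smoothness of the action in charts at the points over the unit.
  have hfs : ∀ z ∈ φ.target,
      ContMDiffAt 𝓘(ℝ, EG × (E × (E →L[ℝ] ℝ))) (IT E) ∞ f (χ 1, z) := by
    intro z hz
    have h1 : ContMDiffAt 𝓘(ℝ, EG × (E × (E →L[ℝ] ℝ))) 𝓘(ℝ, EG) ∞
        (fun ζ : EG × (E × (E →L[ℝ] ℝ)) => χ.symm ζ.1) (χ 1, z) :=
      ContMDiffAt.comp (χ 1, z) hχs contDiff_fst.contMDiff.contMDiffAt
    have h2 : ContMDiffAt 𝓘(ℝ, EG × (E × (E →L[ℝ] ℝ))) (IT E) ∞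
        (fun ζ : EG × (E × (E →L[ℝ] ℝ)) => φ.symm ζ.2) (χ 1, z) :=
      ContMDiffAt.comp (χ 1, z) (contMDiffAt_extChartAt_symm (I := IT E) p hz)
        contDiff_snd.contMDiff.contMDiffAt
    exact contMDiff_lift.contMDiffAt.comp (χ 1, z) (h1.prodMk h2)
  -- The derivative of the action in the direction of the group.
  have hleft : ∀ z ∈ φ.target, ∀ a : EG,
      (mfderiv 𝓘(ℝ, EG × (E × (E →L[ℝ] ℝ))) (IT E) f (χ 1, z) :
        EG × (E × (E →L[ℝ] ℝ)) →L[ℝ] E × (E →L[ℝ] ℝ)) (a, 0) =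
          generatorMap EG G (φ.symm z) a := by
    intro z hz a
    refine (mfderiv_apply_left ((hfs z hz).mdifferentiableAt (by simp)) a).trans ?_
    have h1 : MDifferentiableAt 𝓘(ℝ, EG) (IT E) (fun g : G => lift g (φ.symm z))
        (χ.symm (χ 1)) := (contMDiff_lift_right _).mdifferentiableAt (by simp)
    have h2 : (mfderiv 𝓘(ℝ, EG) (IT E) (fun g : G => lift g (φ.symm z)) (χ.symm (χ 1)) :
        EG →L[ℝ] E × (E →L[ℝ] ℝ)) = mfderiv 𝓘(ℝ, EG) (IT E) (fun g : G => lift g (φ.symm z)) 1 :=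
      mfderiv_eq_of_point_eq hχ1
    refine (DFunLike.congr_fun
      (mfderiv_comp (χ 1) h1 (hχs.mdifferentiableAt (by simp))) a).trans ?_
    refine (congrArg (mfderiv 𝓘(ℝ, EG) (IT E) (fun g : G => lift g (φ.symm z)) (χ.symm (χ 1)) :
      EG →L[ℝ] E × (E →L[ℝ] ℝ))
        (DFunLike.congr_fun (mfderiv_extChartAt_symm_self (I := 𝓘(ℝ, EG)) (1 : G)) a)).trans ?_
    exact DFunLike.congr_fun h2 a
  have hright : ∀ W : E × (E →L[ℝ] ℝ),
      (mfderiv 𝓘(ℝ, EG × (E × (E →L[ℝ] ℝ))) (IT E) f (χ 1, φ p) :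
        EG × (E × (E →L[ℝ] ℝ)) →L[ℝ] E × (E →L[ℝ] ℝ)) (0, W) = W := by
    intro W
    refine (mfderiv_apply_right
      ((hfs _ (mem_extChartAt_target p)).mdifferentiableAt (by simp)) W).trans ?_
    have h1 : (fun z => f (χ 1, z)) = φ.symm := by
      funext z
      simp only [hf, hχ1]
      exact lift_one _
    rw [h1]
    exact DFunLike.congr_fun (mfderiv_extChartAt_symm_self (I := IT E) p) W
  have hD : ∀ W : EG × (E × (E →L[ℝ] ℝ)),
      (mfderiv 𝓘(ℝ, EG × (E × (E →L[ℝ] ℝ))) (IT E) f (χ 1, φ p) :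
        EG × (E × (E →L[ℝ] ℝ)) →L[ℝ] E × (E →L[ℝ] ℝ)) W =
          generatorMap EG G p W.1 + W.2 := by
    intro W
    have h1 : W = (W.1, 0) + (0, W.2) := by simp
    have h2 := hleft (φ p) (mem_extChartAt_target p) W.1
    rw [hφp] at h2
    refine (congrArg (mfderiv 𝓘(ℝ, EG × (E × (E →L[ℝ] ℝ))) (IT E) f (χ 1, φ p) :
      EG × (E × (E →L[ℝ] ℝ)) →L[ℝ] E × (E →L[ℝ] ℝ)) h1).trans ?_
    exact (ContinuousLinearMap.map_add _ _ _).trans (congrArg₂ (· + ·) h2 (hright W.2))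
  have hmain := canonicalForm_mfderiv_sub_of_hasDerivAt (hfs _ (mem_extChartAt_target p)) hD
    (X := (a, 0)) (Y := (0, Y)) (θY := fun _ => canonicalForm E (φ p) Y)
    (θX := fun t => momentumMap E M EG G (φ.symm (φ p + t • Y)) a) (c := 0)
    (d := momentumDeriv E M EG G p Y a) ?_ (hasDerivAt_const _ _) ?_ ?_
  · rw [symplecticForm_apply]
    simpa using hmain
  · have h1 : Filter.Tendsto (fun t : ℝ => (χ 1 + t • a, φ p)) (𝓝 0) (𝓝 (χ 1, φ p)) :=
      Continuous.tendsto' (by fun_prop) _ _ (by simp)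
    have h2 : ∀ᶠ ζ in 𝓝 (χ 1, φ p), ContMDiffAt 𝓘(ℝ, EG × (E × (E →L[ℝ] ℝ))) (IT E) 1 f ζ :=
      (contMDiffAt_iff_contMDiffAt_nhds (by simp)).1
        ((hfs _ (mem_extChartAt_target p)).of_le (by norm_cast))
    filter_upwards [h1.eventually h2] with t ht
    have h3 : (χ 1, φ p) + t • ((a, 0) : EG × (E × (E →L[ℝ] ℝ))) = (χ 1 + t • a, φ p) := by simp
    rw [h3]
    refine Eq.trans ?_ (liouville_lift_chart (EG := EG) (χ.symm (χ 1 + t • a)) p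
      (mem_extChartAt_target p) Y)
    exact congrArg (liouville E M (f (χ 1 + t • a, φ p)))
      (mfderiv_apply_right (ht.mdifferentiableAt (by simp)) Y)
  · have h1 : Filter.Tendsto (fun t : ℝ => φ p + t • Y) (𝓝 0) (𝓝 (φ p)) :=
      Continuous.tendsto' (by fun_prop) _ _ (by simp)
    filter_upwards [h1 (extChartAt_target_mem_nhds (I := IT E) p)] with t ht
    have h3 : (χ 1, φ p) + t • ((0, Y) : EG × (E × (E →L[ℝ] ℝ))) = (χ 1, φ p + t • Y) := by simp
    rw [h3]
    refine Eq.trans ?_ (liouville_generator (φ.symm (φ p + t • Y)) a)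
    have h4 : f (χ 1, φ p + t • Y) = φ.symm (φ p + t • Y) := by
      simp only [hf, hχ1]
      exact lift_one _
    refine (congrArg (liouville E M (f (χ 1, φ p + t • Y))) (hleft _ ht a)).trans ?_
    have h5 : (liouville E M (f (χ 1, φ p + t • Y)) : E × (E →L[ℝ] ℝ) →L[ℝ] ℝ) =
        liouville E M (φ.symm (φ p + t • Y)) := liouville_congr h4
    exact DFunLike.congr_fun h5 _
  · have h1 : HasDerivAt (fun t : ℝ => φ p + t • Y) Y 0 := by
      simpa using ((hasDerivAt_id (0 : ℝ)).smul_const Y).const_add (φ p)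
    have h2 := hasFDerivAt_momentumMap_chart (EG := EG) (G := G) p
    rw [show extChartAt (IT E) p p = φ p + (0 : ℝ) • Y by simp [hφ]] at h2
    exact (ContinuousLinearMap.apply ℝ ℝ a).hasFDerivAt.comp_hasDerivAt (0 : ℝ)
      (h2.comp_hasDerivAt (0 : ℝ) h1)

end MomentumForm

/-! ### Curves in level sets -/

section Curves

variable {F H : Type*} [NormedAddCommGroup F] [NormedSpace ℝ F] [TopologicalSpace H]
  {I : ModelWithCorners ℝ F H} {N : Type*} [TopologicalSpace N] [ChartedSpace H N]
  {F' H' : Type*} [NormedAddCommGroup F'] [NormedSpace ℝ F'] [TopologicalSpace H']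
  {I' : ModelWithCorners ℝ F' H'} {N' : Type*} [TopologicalSpace N'] [ChartedSpace H' N']
  {S : Set N} {x : N} {γ : ℝ → N} {w : F}

/-- Outside a neighbourhood of time `0` a curve may be replaced by a constant one. -/
theorem exists_isCurveIn_of_eventually (hx : γ 0 = x) (hγ : ContMDiffAt 𝓘(ℝ, ℝ) I ∞ γ 0)
    (hw : (mfderiv 𝓘(ℝ, ℝ) I γ 0 : ℝ →L[ℝ] F) 1 = w) (hS : ∀ᶠ t in 𝓝 0, γ t ∈ S) :
    ∃ γ' : ℝ → N, IsCurveIn I S x γ' w := by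
  classical
  have hxS : x ∈ S := hx ▸ hS.self_of_nhds
  have he : (fun t => if γ t ∈ S then γ t else x) =ᶠ[𝓝 0] γ := by
    filter_upwards [hS] with t ht
    exact if_pos ht
  refine ⟨fun t => if γ t ∈ S then γ t else x, fun t => ?_, ?_, hγ.congr_of_eventuallyEq he, ?_⟩
  · split_ifs with h
    exacts [h, hxS]
  · simp [hx]
  · rw [he.mfderiv_eq]
    exact hw

theorem IsCurveIn.map {S' : Set N'} {f : N → N'} (hγ : IsCurveIn I S x γ w)
    (hf : ContMDiffAt I I' ∞ f x) (hS : ∀ y ∈ S, f y ∈ S') :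
    IsCurveIn I' S' (f x) (f ∘ γ) ((mfderiv I I' f x : F →L[ℝ] F') w) := by
  obtain ⟨h1, rfl, h3, h4⟩ := hγ
  refine ⟨fun t => hS _ (h1 t), rfl, hf.comp 0 h3, ?_⟩
  refine (DFunLike.congr_fun (mfderiv_comp (0 : ℝ) (hf.mdifferentiableAt (by simp))
    (h3.mdifferentiableAt (by simp))) 1).trans ?_
  exact congrArg (mfderiv I I' f (γ 0) : F →L[ℝ] F') h4

theorem IsCurveIn.hasDerivAt_comp {V : Type*} [NormedAddCommGroup V] [NormedSpace ℝ V] {f : N → V}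
    (hγ : IsCurveIn I S x γ w) (hf : MDifferentiableAt I 𝓘(ℝ, V) f x) :
    HasDerivAt (f ∘ γ) ((mfderiv I 𝓘(ℝ, V) f x : F →L[ℝ] V) w) 0 := by
  obtain ⟨h1, rfl, h3, h4⟩ := hγ
  obtain ⟨A, hA⟩ : ∃ A : F →L[ℝ] V, A = mfderiv I 𝓘(ℝ, V) f (γ 0) := ⟨_, rfl⟩
  obtain ⟨B, hB⟩ : ∃ B : ℝ →L[ℝ] F, B = mfderiv 𝓘(ℝ, ℝ) I γ 0 := ⟨_, rfl⟩
  have h5 : HasMFDerivAt 𝓘(ℝ, ℝ) 𝓘(ℝ, V) (f ∘ γ) 0 (A.comp B) := by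
    rw [hA, hB]
    exact hf.hasMFDerivAt.comp (0 : ℝ) (h3.mdifferentiableAt (by simp)).hasMFDerivAt
  have h6 : HasFDerivAt (f ∘ γ) (A.comp B) 0 := hasMFDerivAt_iff_hasFDerivAt.1 h5
  have h7 : B 1 = w := by rw [hB]; exact h4
  refine h6.hasDerivAt.congr_deriv ?_
  rw [ContinuousLinearMap.comp_apply, h7, hA]
  rfl

/-- The derivative of a function that is constant on `S` vanishes on the tangent vectors to `S`. -/
theorem mfderiv_eq_zero_of_mem_tangentOf {V : Type*} [NormedAddCommGroup V] [NormedSpace ℝ V]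
    {f : N → V} (hf : MDifferentiableAt I 𝓘(ℝ, V) f x) {c : V} (hc : ∀ y ∈ S, f y = c)
    (hw : (show TangentSpace I x from w) ∈ tangentOf I S x) :
    (mfderiv I 𝓘(ℝ, V) f x : F →L[ℝ] V) w = 0 := by
  have h : tangentOf I S x ≤ LinearMap.ker (mfderiv I 𝓘(ℝ, V) f x : F →L[ℝ] V).toLinearMap := by
    refine Submodule.span_le.2 ?_
    rintro v ⟨γ, hγ⟩
    have h1 := hγ.hasDerivAt_comp hf
    have h2 : f ∘ γ = fun _ => c := funext fun t => hc _ (hγ.mem t)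
    rw [h2] at h1
    exact h1.unique (hasDerivAt_const _ _)
  exact h hw

/-- A regular level set has, at each of its points, the tangent vectors in the kernel of the
derivative as velocities of curves. -/
theorem exists_isCurveIn_levelSet [I.Boundaryless] [IsManifold I ∞ N] {W : Type*}
    [NormedAddCommGroup W] [NormedSpace ℝ W] [FiniteDimensional ℝ W] {l : N → W}
    {D : F →L[ℝ] W} (hl : ContMDiffAt I 𝓘(ℝ, W) ∞ l x)
    (hD : HasFDerivAt (fun z => l ((extChartAt I x).symm z)) D (extChartAt I x x))
    (hsurj : Function.Surjective D) (hw : D w = 0) :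
    ∃ γ : ℝ → N, IsCurveIn I {y | l y = l x} x γ w := by
  set φ := extChartAt I x with hφ
  have hφx : φ.symm (φ x) = x := φ.left_inv (mem_extChartAt_source x)
  have hs := contMDiffAt_extChartAt_symm (I := I) x (mem_extChartAt_target x)
  have hl' : ContDiffAt ℝ ∞ (fun z => l (φ.symm z)) (φ x) := by
    refine ContMDiffAt.contDiffAt (ContMDiffAt.comp (φ x) ?_ hs)
    rwa [hφx]
  obtain ⟨c, hc, hc0, hcw, hcl⟩ := exists_curve_in_fiber hl'
    (by rw [hD.fderiv]; exact hsurj) (by rw [hD.fderiv]; exact hw)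
  have hs' : ContMDiffAt 𝓘(ℝ, F) I ∞ φ.symm (c 0) := by rw [hc0]; exact hs
  refine exists_isCurveIn_of_eventually (γ := φ.symm ∘ c) ?_ ?_ ?_ ?_
  · simp [hc0, hφx]
  · exact hs'.comp (0 : ℝ) hc.contMDiffAt
  · have h1 := hcw.hasFDerivAt.hasMFDerivAt
    refine (DFunLike.congr_fun ((hs'.mdifferentiableAt (by simp)).hasMFDerivAt.comp
      (0 : ℝ) h1).mfderiv (1 : ℝ)).trans ?_
    have h2 : (mfderiv 𝓘(ℝ, F) I φ.symm (c 0) : F →L[ℝ] F) = ContinuousLinearMap.id ℝ F :=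
      (mfderiv_eq_of_point_eq hc0).trans (mfderiv_extChartAt_symm_self x)
    exact (DFunLike.congr_fun h2 _).trans (one_smul ℝ w)
  · filter_upwards [hcl] with t ht
    simpa [hφx] using ht

end Curves

/-! ### Integral curves of left-invariant fields -/

section LieGroupCurves

variable {EG : Type*} [NormedAddCommGroup EG] [NormedSpace ℝ EG]
  {G : Type*} [TopologicalSpace G] [ChartedSpace EG G] [Group G]

/-- The left-invariant vector field with value `a` at `1`, read in the chart at `1`. -/
noncomputable def invariantFieldChart (G : Type*) [TopologicalSpace G] [ChartedSpace EG G] [Group G]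
    [LieGroup 𝓘(ℝ, EG) ∞ G] (a : EG) (g : G) : EG :=
  haveI : IsManifold 𝓘(ℝ, EG) 1 G := IsManifold.of_le (n := ∞) (by simp)
  tangentCoordChange 𝓘(ℝ, EG) g 1 g (mulInvariantVectorField (I := 𝓘(ℝ, EG)) (G := G) a g)

theorem contMDiffAt_invariantFieldChart [LieGroup 𝓘(ℝ, EG) ∞ G] (a : EG) :
    ContMDiffAt 𝓘(ℝ, EG) 𝓘(ℝ, EG) ∞ (invariantFieldChart G a) 1 := by
  have hf : ContMDiff (𝓘(ℝ, EG).prod 𝓘(ℝ, EG)) 𝓘(ℝ, EG) ∞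
      (Function.uncurry fun g h : G => g * h) := contMDiff_mul 𝓘(ℝ, EG) ∞
  have h1 := ContMDiffAt.mfderiv (m := ∞) (x₀ := (1 : G)) _ (fun _ => (1 : G)) (hf _)
    contMDiffAt_const (by simp)
  have h2 : (fun g : G => g * 1) = fun g => g := by
    ext g; exact mul_one _
  have h3 := (congrArg (fun k => ContMDiffAt 𝓘(ℝ, EG) 𝓘(ℝ, EG →L[ℝ] EG) ∞
    (inTangentCoordinates 𝓘(ℝ, EG) 𝓘(ℝ, EG) (fun _ : G => (1 : G)) k
      (fun g : G => (mfderiv 𝓘(ℝ, EG) 𝓘(ℝ, EG) (fun h : G => g * h) 1 :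
        EG →L[ℝ] EG)) 1) 1) h2).mp h1
  refine (h3.clm_apply (contMDiffAt_const (c := a))).congr_of_eventuallyEq ?_
  filter_upwards [chart_source_mem_nhds EG (1 : G)] with g hg
  have h4 := inTangentCoordinates_eq (I := 𝓘(ℝ, EG)) (I' := 𝓘(ℝ, EG)) (fun _ : G => (1 : G))
    (fun g : G => g) (fun g : G => (mfderiv 𝓘(ℝ, EG) 𝓘(ℝ, EG) (fun h : G => g * h) 1 :
        EG →L[ℝ] EG)) (x₀ := (1 : G)) (mem_chart_source EG (1 : G)) hg
  have h5 := (tangentBundleCore 𝓘(ℝ, EG) G).coordChange_self (achart EG (1 : G)) 1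
    (mem_chart_source EG (1 : G)) a
  refine Eq.trans ?_ (DFunLike.congr_fun h4 a).symm
  exact congrArg (fun b => tangentCoordChange 𝓘(ℝ, EG) g 1 g
    ((mfderiv 𝓘(ℝ, EG) 𝓘(ℝ, EG) (fun h : G => g * h) 1 : EG →L[ℝ] EG) b)) h5.symm

theorem mulInvariantVectorField_one (a : EG) :
    (mulInvariantVectorField (I := 𝓘(ℝ, EG)) (G := G) a 1 : EG) = a := by
  have h : (fun g : G => 1 * g) = id := by ext g; simp
  have h1 : (mfderiv 𝓘(ℝ, EG) 𝓘(ℝ, EG) (fun g : G => 1 * g) 1 : EG →L[ℝ] EG) =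
      ContinuousLinearMap.id ℝ EG := (mfderiv_eq_of_eq h rfl).trans mfderiv_id
  exact DFunLike.congr_fun h1 a

/-- A smooth local one-parameter subgroup: the integral curve through `1` of a left-invariant vector
field. -/
theorem exists_isMIntegralCurveAt_mulInvariantVectorField [CompleteSpace EG]
    [LieGroup 𝓘(ℝ, EG) ∞ G] (a : EG) :
    ∃ γ : ℝ → G, γ 0 = 1 ∧ ContMDiffAt 𝓘(ℝ, ℝ) 𝓘(ℝ, EG) ∞ γ 0 ∧
      IsMIntegralCurveAt γ (mulInvariantVectorField (I := 𝓘(ℝ, EG)) (G := G) a) 0 := by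
  have hX := contMDiffAt_invariantFieldChart (G := G) a
  have hsec : ContMDiffAt 𝓘(ℝ, EG) 𝓘(ℝ, EG).tangent 1 (fun g : G =>
      (⟨g, mulInvariantVectorField (I := 𝓘(ℝ, EG)) (G := G) a g⟩ : TangentBundle 𝓘(ℝ, EG) G)) 1 :=
    Bundle.contMDiffAt_totalSpace.2 ⟨contMDiffAt_id, hX.of_le (by norm_cast)⟩
  obtain ⟨γ, h0, hγ⟩ := exists_isMIntegralCurveAt_of_contMDiffAt_boundaryless (t₀ := 0) hsec
  refine ⟨γ, h0, ?_, hγ⟩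
  set χ := extChartAt 𝓘(ℝ, EG) (1 : G) with hχ
  have hev := hγ.eventually_hasDerivAt
  rw [h0] at hev
  have hsrc : ∀ᶠ t in 𝓝 (0 : ℝ), γ t ∈ χ.source :=
    hγ.continuousAt (by rw [h0]; exact extChartAt_source_mem_nhds 1)
  have hc0 : (χ ∘ γ) 0 = χ 1 := by simp [h0]
  have hs := contMDiffAt_extChartAt_symm (I := 𝓘(ℝ, EG)) (1 : G) (mem_extChartAt_target 1)
  have hc : ContDiffAt ℝ ∞ (χ ∘ γ) 0 := by
    refine contDiffAt_of_hasDerivAt_vectorField (X := fun z => invariantFieldChart G a (χ.symm z))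
      ?_ ?_
    · rw [hc0]
      refine ContMDiffAt.contDiffAt
        (ContMDiffAt.comp (g := invariantFieldChart G a) (χ 1) ?_ hs)
      rw [show χ.symm (χ 1) = 1 from χ.left_inv (mem_extChartAt_source 1)]
      exact hX
    · filter_upwards [hev, hsrc] with t h1 h2
      simp only [Function.comp, χ.left_inv h2]
      exact h1
  have h2 : ContMDiffAt 𝓘(ℝ, ℝ) 𝓘(ℝ, EG) ∞ (χ.symm ∘ χ ∘ γ) 0 :=
    ContMDiffAt.comp (0 : ℝ) (by rw [hc0]; exact hs) hc.contMDiffAt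
  refine h2.congr_of_eventuallyEq ?_
  filter_upwards [hsrc] with t ht
  exact (χ.left_inv ht).symm

end LieGroupCurves

/-! ### Tangent spaces to the level set and to the isotropy orbits -/

section TangentSpaces

variable {E : Type*} [NormedAddCommGroup E] [NormedSpace ℝ E]
  {M : Type*} [TopologicalSpace M] [ChartedSpace E M] [IsManifold 𝓘(ℝ, E) ∞ M]
  {EG : Type*} [NormedAddCommGroup EG] [NormedSpace ℝ EG]
  {G : Type*} [TopologicalSpace G] [ChartedSpace EG G] [Group G] [LieGroup 𝓘(ℝ, EG) ∞ G]
  [MulAction G M]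

/-- The momentum map along the orbit of a point. -/
noncomputable def momentumOrbit {E M : Type*} (EG : Type*) {G : Type*} [NormedAddCommGroup E]
    [NormedSpace ℝ E] [TopologicalSpace M] [ChartedSpace E M] [IsManifold 𝓘(ℝ, E) ∞ M]
    [NormedAddCommGroup EG] [NormedSpace ℝ EG] [TopologicalSpace G] [ChartedSpace EG G] [Group G]
    [MulAction G M] (p : Cotangent E M) (g : G) : EG →L[ℝ] ℝ :=
  momentumMap E M EG G (lift g p)

theorem contMDiff_momentumOrbit [ContMDiffSMul 𝓘(ℝ, EG) 𝓘(ℝ, E) ∞ G M] (p : Cotangent E M) :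
    ContMDiff 𝓘(ℝ, EG) 𝓘(ℝ, EG →L[ℝ] ℝ) ∞ (momentumOrbit (G := G) EG p) :=
  contMDiff_momentumMap.comp (contMDiff_lift_right p)

/-- Equivariance of the momentum map, along an orbit. -/
theorem momentumOrbit_mul [ContMDiffSMul 𝓘(ℝ, EG) 𝓘(ℝ, E) ∞ G M] (p : Cotangent E M) (g h : G) :
    momentumOrbit EG p (g * h) = (momentumOrbit EG p h).comp (adjoint (EG := EG) g⁻¹) :=
  (congrArg (momentumMap E M EG G) (lift_mul EG g h p)).trans (momentum_lift EG g (lift h p))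

theorem mfderiv_momentumOrbit_one [ContMDiffSMul 𝓘(ℝ, EG) 𝓘(ℝ, E) ∞ G M] (p : Cotangent E M)
    (a : EG) :
    (mfderiv 𝓘(ℝ, EG) 𝓘(ℝ, EG →L[ℝ] ℝ) (momentumOrbit (G := G) EG p) 1 :
      EG →L[ℝ] EG →L[ℝ] ℝ) a = momentumDeriv E M EG G p (generatorMap EG G p a) := by
  have hm : MDifferentiableAt (IT E) 𝓘(ℝ, EG →L[ℝ] ℝ) (momentumMap E M EG G) (lift (1 : G) p) :=
    contMDiff_momentumMap.mdifferentiableAt (by simp)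
  have hl : MDifferentiableAt 𝓘(ℝ, EG) (IT E) (fun g : G => lift g p) 1 :=
    (contMDiff_lift_right p).mdifferentiableAt (by simp)
  refine (DFunLike.congr_fun (mfderiv_comp (1 : G) hm hl) a).trans ?_
  exact DFunLike.congr_fun (mfderiv_eq_of_point_eq (lift_one p) :
    (mfderiv (IT E) 𝓘(ℝ, EG →L[ℝ] ℝ) (momentumMap E M EG G) (lift (1 : G) p) :
      E × (E →L[ℝ] ℝ) →L[ℝ] EG →L[ℝ] ℝ) = momentumDeriv E M EG G p) (generatorMap EG G p a)

/-- If the generator of `a` at `p` is tangent to the level set of the momentum map, the momentum map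
is stationary along the whole integral curve of the left-invariant field of `a`, by equivariance. -/
theorem mfderiv_momentumOrbit_mulInvariantVectorField [ContMDiffSMul 𝓘(ℝ, EG) 𝓘(ℝ, E) ∞ G M]
    {p : Cotangent E M} {a : EG} (ha : momentumDeriv E M EG G p (generatorMap EG G p a) = 0)
    (g : G) :
    (mfderiv 𝓘(ℝ, EG) 𝓘(ℝ, EG →L[ℝ] ℝ) (momentumOrbit EG p) g : EG →L[ℝ] EG →L[ℝ] ℝ)
      (mulInvariantVectorField (I := 𝓘(ℝ, EG)) (G := G) a g) = 0 := by
  have hΨ : ∀ h : G, MDifferentiableAt 𝓘(ℝ, EG) 𝓘(ℝ, EG →L[ℝ] ℝ) (momentumOrbit EG p) h :=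
    fun h => (contMDiff_momentumOrbit p).mdifferentiableAt (by simp)
  have hL : MDifferentiableAt 𝓘(ℝ, EG) 𝓘(ℝ, EG) (fun h : G => g * h) 1 :=
    (contMDiff_mul_left (I := 𝓘(ℝ, EG)) (n := ∞)).mdifferentiableAt (by simp)
  obtain ⟨A, hA⟩ : ∃ A : EG →L[ℝ] EG, A = adjoint (EG := EG) g⁻¹ := ⟨_, rfl⟩
  have h1 : momentumOrbit EG p ∘ (fun h : G => g * h) =
      (ContinuousLinearMap.precomp ℝ A : (EG →L[ℝ] ℝ) →L[ℝ] EG →L[ℝ] ℝ) ∘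
        momentumOrbit EG p := by
    funext h
    rw [hA]
    exact momentumOrbit_mul p g h
  have h2 : (mfderiv 𝓘(ℝ, EG) 𝓘(ℝ, EG →L[ℝ] ℝ) (momentumOrbit EG p ∘ fun h : G => g * h) 1 :
      EG →L[ℝ] EG →L[ℝ] ℝ) a = 0 := by
    rw [h1]
    refine (DFunLike.congr_fun (mfderiv_comp (1 : G) (ContinuousLinearMap.differentiableAt
      (ContinuousLinearMap.precomp ℝ A)).mdifferentiableAt (hΨ 1)) a).trans ?_
    refine (DFunLike.congr_fun (mfderiv_eq_fderiv.trans (ContinuousLinearMap.fderiv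
      (ContinuousLinearMap.precomp ℝ A : (EG →L[ℝ] ℝ) →L[ℝ] EG →L[ℝ] ℝ))) _).trans ?_
    refine (congrArg (ContinuousLinearMap.precomp ℝ A : (EG →L[ℝ] ℝ) →L[ℝ] EG →L[ℝ] ℝ)
      ((mfderiv_momentumOrbit_one p a).trans ha)).trans (map_zero _)
  have h3 := (DFunLike.congr_fun (mfderiv_comp (1 : G) (hΨ (g * 1)) hL) a).symm.trans h2
  refine Eq.trans ?_ h3
  exact DFunLike.congr_fun (mfderiv_eq_of_point_eq (mul_one g).symm :
    (mfderiv 𝓘(ℝ, EG) 𝓘(ℝ, EG →L[ℝ] ℝ) (momentumOrbit EG p) g :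
      EG →L[ℝ] EG →L[ℝ] ℝ) = mfderiv 𝓘(ℝ, EG) 𝓘(ℝ, EG →L[ℝ] ℝ) (momentumOrbit EG p) (g * 1)) _

variable {ξ : GroupLieAlgebra 𝓘(ℝ, EG) G →L[ℝ] ℝ}

/-- The Lie algebra of the isotropy group contains every `a` whose generator at some point of
the level set is tangent to the level set. -/
theorem exists_isCurveIn_isotropy [FiniteDimensional ℝ EG]
    [ContMDiffSMul 𝓘(ℝ, EG) 𝓘(ℝ, E) ∞ G M] (x : levelSet E M ξ) {a : EG}
    (ha : momentumDeriv E M EG G (x : Cotangent E M)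
      (generatorMap EG G (x : Cotangent E M) a) = 0) :
    ∃ γ : ℝ → G, IsCurveIn 𝓘(ℝ, EG) (isotropy ξ : Set G) 1 γ a := by
  have : CompleteSpace EG := FiniteDimensional.complete ℝ EG
  obtain ⟨γ, h0, hs, hγ⟩ := exists_isMIntegralCurveAt_mulInvariantVectorField (G := G) a
  set p : Cotangent E M := (x : Cotangent E M) with hp
  -- The momentum map has zero derivative along `γ`, so it keeps its value `ξ` near time `0`; by
  -- equivariance `γ` then lies in the isotropy group of `ξ`.
  have hd : ∀ᶠ t in 𝓝 (0 : ℝ), HasFDerivAt (momentumOrbit EG p ∘ γ)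
      (0 : ℝ →L[ℝ] EG →L[ℝ] ℝ) t := by
    filter_upwards [hγ] with t ht
    have hΨ : MDifferentiableAt 𝓘(ℝ, EG) 𝓘(ℝ, EG →L[ℝ] ℝ) (momentumOrbit EG p) (γ t) :=
      (contMDiff_momentumOrbit p).mdifferentiableAt (by simp)
    have h1 := hasMFDerivAt_iff_hasFDerivAt.1 (hΨ.hasMFDerivAt.comp t ht)
    refine h1.congr_fderiv (ContinuousLinearMap.ext_ring ?_)
    refine Eq.trans (congrArg (mfderiv 𝓘(ℝ, EG) 𝓘(ℝ, EG →L[ℝ] ℝ) (momentumOrbit EG p) (γ t) :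
      EG →L[ℝ] EG →L[ℝ] ℝ) (one_smul ℝ
        (mulInvariantVectorField (I := 𝓘(ℝ, EG)) (G := G) a (γ t) : EG))) ?_
    exact mfderiv_momentumOrbit_mulInvariantVectorField ha (γ t)
  obtain ⟨ε, hε, hball⟩ := Metric.eventually_nhds_iff_ball.1 hd
  have hconst : ∀ t ∈ Metric.ball (0 : ℝ) ε, momentumOrbit EG p (γ t) = ξ := by
    intro t ht
    have h1 := Metric.isOpen_ball.is_const_of_fderiv_eq_zero (𝕜 := ℝ)
      (convex_ball (0 : ℝ) ε).isPreconnected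
      (fun s hs => (hball s hs).differentiableAt.differentiableWithinAt)
      (fun s hs => (hball s hs).fderiv) ht (Metric.mem_ball_self hε)
    refine h1.trans ?_
    simp only [Function.comp, h0]
    exact (congrArg (momentumMap E M EG G) (lift_one p)).trans x.2
  refine exists_isCurveIn_of_eventually h0 hs ?_ ?_
  · refine (DFunLike.congr_fun hγ.hasMFDerivAt.mfderiv (1 : ℝ)).trans ?_
    refine (one_smul ℝ (mulInvariantVectorField (I := 𝓘(ℝ, EG)) (G := G) a (γ 0) : EG)).trans ?_
    rw [h0]
    exact mulInvariantVectorField_one a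
  · filter_upwards [Metric.ball_mem_nhds (0 : ℝ) hε] with t ht
    have h1 : momentum (EG := EG) (lift (γ t) p) = ξ := hconst t ht
    have h2 := momentum_lift EG (γ t) p
    rw [h1, show momentum (EG := EG) (G := G) p = ξ from x.2] at h2
    exact h2.symm

/-- At a regular value, a vector in the kernel of the derivative of the momentum map is the velocity
of a curve in the level set. -/
theorem exists_isCurveIn_level [FiniteDimensional ℝ EG] [ContMDiffSMul 𝓘(ℝ, EG) 𝓘(ℝ, E) ∞ G M]
    (hreg : IsRegularMomentum E M ξ) (x : levelSet E M ξ) {w : E × (E →L[ℝ] ℝ)}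
    (hw : momentumDeriv E M EG G (x : Cotangent E M) w = 0) :
    ∃ γ : ℝ → Cotangent E M, IsCurveIn (IT E) (levelSet E M ξ) (x : Cotangent E M) γ w := by
  obtain ⟨γ, hγ⟩ := exists_isCurveIn_levelSet (I := IT E)
    (contMDiff_momentumMap (E := E) (M := M) (EG := EG) (G := G)).contMDiffAt
    (hasFDerivAt_momentumMap_chart (EG := EG) (G := G) (x : Cotangent E M))
    (hreg x x.2) hw
  exact ⟨γ, fun t => (hγ.mem t).trans x.2, hγ.init, hγ.smooth, hγ.velocity⟩

/-- The tangent space to a regular level set is the kernel of the derivative of the momentum map. -/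
theorem mem_levelTangent_iff [FiniteDimensional ℝ EG] [ContMDiffSMul 𝓘(ℝ, EG) 𝓘(ℝ, E) ∞ G M]
    (hreg : IsRegularMomentum E M ξ) (x : levelSet E M ξ) (w : E × (E →L[ℝ] ℝ)) :
    (show TangentSpace (IT E) (x : Cotangent E M) from w) ∈ levelTangent x ↔
      momentumDeriv E M EG G (x : Cotangent E M) w = 0 := by
  constructor
  · intro hw
    exact mfderiv_eq_zero_of_mem_tangentOf
      ((contMDiff_momentumMap (E := E) (M := M) (EG := EG) (G := G)).mdifferentiableAt (by simp))
      (fun y hy => hy) hw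
  · intro hw
    exact Submodule.subset_span (exists_isCurveIn_level hreg x hw)

/-- The tangent space to the orbit of the isotropy group consists of the vectors that are tangent
both to the `G`-orbit and to the level set. -/
theorem mem_isotropyOrbitTangent_iff [FiniteDimensional ℝ EG]
    [ContMDiffSMul 𝓘(ℝ, EG) 𝓘(ℝ, E) ∞ G M] (x : levelSet E M ξ) (w : E × (E →L[ℝ] ℝ)) :
    (show TangentSpace (IT E) (x : Cotangent E M) from w) ∈ isotropyOrbitTangent x ↔
      (∃ a, generatorMap EG G (x : Cotangent E M) a = w) ∧
        momentumDeriv E M EG G (x : Cotangent E M) w = 0 := by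
  constructor
  · rintro ⟨a, ha, haw⟩
    refine ⟨⟨a, haw⟩, ?_⟩
    have h1 := mfderiv_eq_zero_of_mem_tangentOf (I := 𝓘(ℝ, EG)) (F := EG) (V := EG →L[ℝ] ℝ) (w := a)
      ((contMDiff_momentumOrbit (EG := EG) (G := G) (x : Cotangent E M)).mdifferentiableAt
        (by simp))
      (c := show EG →L[ℝ] ℝ from ξ) (fun g hg => ((⟨g, hg⟩ : isotropy ξ) • x).2) ha
    refine (congrArg (momentumDeriv E M EG G (x : Cotangent E M)) haw).symm.trans ?_
    exact (mfderiv_momentumOrbit_one (EG := EG) (G := G) (x : Cotangent E M) a).symm.trans h1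
  · rintro ⟨⟨a, rfl⟩, ha⟩
    exact ⟨a, Submodule.subset_span (exists_isCurveIn_isotropy x ha), rfl⟩

end TangentSpaces

/-! ### Extension of functions from the level set -/

section Extension

variable {E : Type*} [NormedAddCommGroup E] [NormedSpace ℝ E]
  {M : Type*} [TopologicalSpace M] [ChartedSpace E M] [IsManifold 𝓘(ℝ, E) ∞ M]

theorem t2Space_totalSpace {B F : Type*} [TopologicalSpace B] [T2Space B] [TopologicalSpace F]
    [T2Space F] (V : B → Type*) [TopologicalSpace (Bundle.TotalSpace F V)]
    [∀ b, TopologicalSpace (V b)] [FiberBundle F V] : T2Space (Bundle.TotalSpace F V) := by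
  refine ⟨fun p q hpq => ?_⟩
  by_cases h : p.1 = q.1
  · set e := trivializationAt F V p.1
    have hp : p ∈ e.source := e.mem_source.2 (FiberBundle.mem_baseSet_trivializationAt' p.1)
    have hq : q ∈ e.source :=
      e.mem_source.2 (h ▸ FiberBundle.mem_baseSet_trivializationAt' p.1)
    obtain ⟨U, W, hU, hW, hpU, hqW, hd⟩ := t2_separation (e.injOn.ne hp hq hpq)
    refine ⟨_, _, e.toOpenPartialHomeomorph.isOpen_inter_preimage hU,
      e.toOpenPartialHomeomorph.isOpen_inter_preimage hW, ⟨hp, hpU⟩, ⟨hq, hqW⟩, ?_⟩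
    exact (hd.preimage _).mono Set.inter_subset_right Set.inter_subset_right
  · exact separated_by_continuous (FiberBundle.continuous_proj F V) h

theorem secondCountableTopology_cotangent [FiniteDimensional ℝ E] [SecondCountableTopology M] :
    SecondCountableTopology (Cotangent E M) := by
  obtain ⟨s, hs, hcov⟩ := TopologicalSpace.countable_cover_nhds
    (fun u : M => chart_source_mem_nhds E u)
  have : SecondCountableTopology (ModelProd E (E →L[ℝ] ℝ)) :=
    inferInstanceAs (SecondCountableTopology (E × (E →L[ℝ] ℝ)))
  refine ChartedSpace.secondCountable_of_countable_cover (ModelProd E (E →L[ℝ] ℝ))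
    (s := (fun u : M => (⟨u, (0 : E →L[ℝ] ℝ)⟩ : Cotangent E M)) '' s) ?_ (hs.image _)
  refine Set.eq_univ_of_forall fun q => ?_
  have hq : q.1 ∈ ⋃ u ∈ s, (chartAt E u).source := hcov ▸ Set.mem_univ _
  obtain ⟨u, hu, hqu⟩ := Set.mem_iUnion₂.1 hq
  refine Set.mem_iUnion₂.2 ⟨⟨u, (0 : E →L[ℝ] ℝ)⟩, ⟨u, hu, rfl⟩, ?_⟩
  rw [← extChartAt_source (IT E)]
  exact (mem_source_iff _ q).2 hqu

variable {EG : Type*} [NormedAddCommGroup EG] [NormedSpace ℝ EG]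
  {G : Type*} [TopologicalSpace G] [ChartedSpace EG G] [Group G] [LieGroup 𝓘(ℝ, EG) ∞ G]
  [MulAction G M] {ξ : GroupLieAlgebra 𝓘(ℝ, EG) G →L[ℝ] ℝ}

theorem isClosed_levelSet [ContMDiffSMul 𝓘(ℝ, EG) 𝓘(ℝ, E) ∞ G M] :
    IsClosed (levelSet E M ξ) :=
  isClosed_singleton.preimage
    (contMDiff_momentumMap (E := E) (M := M) (EG := EG) (G := G)).continuous

/-- A smooth function on the reduced space has a smooth extension to the whole cotangent bundle,
by a partition of unity. -/
theorem exists_isExtension_univ [FiniteDimensional ℝ E] [T2Space M] [SecondCountableTopology M]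
    [ContMDiffSMul 𝓘(ℝ, EG) 𝓘(ℝ, E) ∞ G M] {f : ReducedSpace E M ξ → ℝ}
    (hf : IsSmoothReduced f) : ∃ F : Cotangent E M → ℝ, IsExtension f Set.univ F := by
  have : T2Space (Cotangent E M) := t2Space_totalSpace _
  have : SecondCountableTopology (Cotangent E M) := secondCountableTopology_cotangent
  have : LocallyCompactSpace (Cotangent E M) := Manifold.locallyCompact_of_finiteDimensional (IT E)
  set t : Cotangent E M → Set ℝ := fun y =>
    {c | ∀ h : y ∈ levelSet E M ξ, c = f (reduce ⟨y, h⟩)} with ht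
  have hconv : ∀ y, Convex ℝ (t y) := by
    intro y c hc c' hc' a b _ _ hab h
    rw [hc h, hc' h, ← add_smul, hab, one_smul]
  have hloc : ∀ y, ∃ U ∈ 𝓝 y, ∃ g : Cotangent E M → ℝ,
      ContMDiffOn (IT E) 𝓘(ℝ, ℝ) ∞ g U ∧ ∀ z ∈ U, g z ∈ t z := by
    intro y
    by_cases hy : y ∈ levelSet E M ξ
    · obtain ⟨U, F, hyU, hF⟩ := hf ⟨y, hy⟩
      exact ⟨U, hF.isOpen.mem_nhds hyU, F, hF.smooth, fun z hz h => hF.eq ⟨z, h⟩ hz⟩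
    · exact ⟨(levelSet E M ξ)ᶜ, isClosed_levelSet.isOpen_compl.mem_nhds hy, fun _ => 0,
        contMDiffOn_const, fun z hz h => absurd h hz⟩
  obtain ⟨F, hF⟩ := exists_contMDiffMap_forall_mem_convex_of_local (IT E) (n := ⊤) hconv hloc
  exact ⟨F, isOpen_univ, F.contMDiff.contMDiffOn, fun y _ => hF y y.2⟩

end Extension

/-! ### Symplectic linear algebra and Hamiltonian vectors -/

/-- A reflexive form on `W` whose kernel is `N` induces a nondegenerate form on `W ⧸ N`. -/
theorem exists_nondegenerate_bilinForm_quotient {V : Type*} [AddCommGroup V] [Module ℝ V]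
    {S : LinearMap.BilinForm ℝ V} (hr : S.IsRefl) {W : Submodule ℝ V} {N : Submodule ℝ W}
    (hN : ∀ n : W, n ∈ N ↔ ∀ w : W, S n w = 0) :
    ∃ B : LinearMap.BilinForm ℝ (W ⧸ N),
      (∀ u v : W, B (N.mkQ u) (N.mkQ v) = S u v) ∧ B.Nondegenerate := by
  set R : W →ₗ[ℝ] W →ₗ[ℝ] ℝ := (S.domRestrict₁₂ W W) with hR
  have hR1 : N ≤ LinearMap.ker R := fun n hn => LinearMap.ext fun w => (hN n).1 hn w
  set R₁ : W →ₗ[ℝ] (W ⧸ N) →ₗ[ℝ] ℝ := (N.liftQ R hR1).flip with hR₁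
  have hR2 : N ≤ LinearMap.ker R₁ := by
    intro n hn
    refine LinearMap.ext fun u => ?_
    obtain ⟨u, rfl⟩ := N.mkQ_surjective u
    exact hr _ _ ((hN n).1 hn u)
  have hB : ∀ u v : W, (N.liftQ R₁ hR2).flip (N.mkQ u) (N.mkQ v) = S u v := fun u v => rfl
  refine ⟨(N.liftQ R₁ hR2).flip, hB, fun u hu => ?_, fun u hu => ?_⟩
  · obtain ⟨u, rfl⟩ := N.mkQ_surjective u
    exact (Submodule.Quotient.mk_eq_zero N).2
      ((hN u).2 fun w => (hB u w).symm.trans (hu (N.mkQ w)))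
  · obtain ⟨u, rfl⟩ := N.mkQ_surjective u
    exact (Submodule.Quotient.mk_eq_zero N).2
      ((hN u).2 fun w => hr _ _ ((hB w u).symm.trans (hu (N.mkQ w))))

section Hamiltonian

variable {E : Type*} [NormedAddCommGroup E] [NormedSpace ℝ E]
  {M : Type*} [TopologicalSpace M] [ChartedSpace E M] [IsManifold 𝓘(ℝ, E) ∞ M]

/-- The differential of a function on the cotangent bundle, as a linear form on the model space. -/
noncomputable def differential (F : Cotangent E M → ℝ) (p : Cotangent E M) :
    (E × (E →L[ℝ] ℝ)) →L[ℝ] ℝ :=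
  mfderiv (IT E) 𝓘(ℝ, ℝ) F p

/-- Hamiltonian vectors exist and are unique, since `ω` is nondegenerate. -/
theorem existsUnique_isHamiltonianVector [FiniteDimensional ℝ E] (F : Cotangent E M → ℝ)
    (p : Cotangent E M) : ∃! K, IsHamiltonianVector F p K := by
  have hS := nondegenerate_symplecticForm (E := E)
  set K : E × (E →L[ℝ] ℝ) := ((symplecticForm E).toDual hS).symm
    (-(differential F p : E × (E →L[ℝ] ℝ) →ₗ[ℝ] ℝ)) with hK
  have h1 : ∀ Y : E × (E →L[ℝ] ℝ), symplecticForm E K Y = -differential F p Y := fun Y =>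
    LinearMap.BilinForm.apply_toDual_symm_apply (hB := hS) _ Y
  refine ⟨K, fun Y => (omega_eq p K Y).trans (h1 Y), fun K' hK' => ?_⟩
  refine sub_eq_zero.1 (eq_zero_of_symplecticForm_eq_zero (E := E) fun Y => ?_)
  have h2 : symplecticForm E K' Y = -differential F p Y := (omega_eq p K' Y).symm.trans (hK' Y)
  refine (LinearMap.map_sub₂ (symplecticForm E) (K' : E × (E →L[ℝ] ℝ)) K Y).trans ?_
  rw [h1, h2, sub_self]

theorem symplecticForm_hamiltonianField [FiniteDimensional ℝ E] (F : Cotangent E M → ℝ)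
    (p : Cotangent E M) (Y : E × (E →L[ℝ] ℝ)) :
    symplecticForm E (show E × (E →L[ℝ] ℝ) from hamiltonianField F p) Y = -differential F p Y :=
  (omega_eq p (hamiltonianField F p) Y).symm.trans
    (Classical.epsilon_spec (existsUnique_isHamiltonianVector F p).exists Y)

/-- The correction terms of the reduced bracket: with `K_i + V_i` orthogonal to the orbit directions
`V_1` and `V_2`, the product `ω(V_1, V_2)` equals `½ (dF_1 V_2 - dF_2 V_1)`. -/
theorem symplecticForm_add_add_eq {K₁ K₂ V₁ V₂ : E × (E →L[ℝ] ℝ)}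
    (h₁ : symplecticForm E V₁ (K₂ + V₂) = 0) (h₂ : symplecticForm E V₂ (K₁ + V₁) = 0) :
    symplecticForm E (K₁ + V₁) (K₂ + V₂) = symplecticForm E K₁ K₂ +
      1 / 2 * (symplecticForm E K₁ V₂ - symplecticForm E K₂ V₁) := by
  have e1 := symplecticForm_swap V₂ K₁
  have e2 := symplecticForm_swap V₁ K₂
  have e3 := symplecticForm_swap V₁ V₂
  simp only [map_add, LinearMap.add_apply] at h₁ h₂ ⊢
  linarith

end Hamiltonian

/-! ### The reduced form and reduced Hamiltonian vectors -/

section Reduction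

variable {E : Type*} [NormedAddCommGroup E] [NormedSpace ℝ E]
  {M : Type*} [TopologicalSpace M] [ChartedSpace E M] [IsManifold 𝓘(ℝ, E) ∞ M]
  {EG : Type*} [NormedAddCommGroup EG] [NormedSpace ℝ EG]
  {G : Type*} [TopologicalSpace G] [ChartedSpace EG G] [Group G] [LieGroup 𝓘(ℝ, EG) ∞ G]
  [MulAction G M] {ξ : GroupLieAlgebra 𝓘(ℝ, EG) G →L[ℝ] ℝ}

/-- The tangent space to a regular level set is the symplectic orthogonal of the tangent space to
the orbit. -/
theorem mem_levelTangent_iff_mem_orthogonal [FiniteDimensional ℝ EG]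
    [ContMDiffSMul 𝓘(ℝ, EG) 𝓘(ℝ, E) ∞ G M] (hreg : IsRegularMomentum E M ξ) (x : levelSet E M ξ)
    (w : E × (E →L[ℝ] ℝ)) :
    (show TangentSpace (IT E) (x : Cotangent E M) from w) ∈ levelTangent x ↔
      w ∈ (symplecticForm E).orthogonal (LinearMap.range
        (generatorMap EG G (x : Cotangent E M)).toLinearMap) := by
  rw [mem_levelTangent_iff hreg x w]
  constructor
  · rintro h _ ⟨a, rfl⟩
    refine (omega_generator (x : Cotangent E M) a w).trans ?_
    rw [h, zero_apply, neg_zero]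
  · intro h
    refine ContinuousLinearMap.ext fun a => ?_
    have h1 := (omega_generator (x : Cotangent E M) a w).symm.trans (h _ ⟨a, rfl⟩)
    exact neg_eq_zero.1 h1

theorem symplecticForm_orbit_level_eq_zero [FiniteDimensional ℝ EG]
    [ContMDiffSMul 𝓘(ℝ, EG) 𝓘(ℝ, E) ∞ G M] (hreg : IsRegularMomentum E M ξ) {x : levelSet E M ξ}
    {V w : E × (E →L[ℝ] ℝ)}
    (hV : (show TangentSpace (IT E) (x : Cotangent E M) from V) ∈ orbitTangent x)
    (hw : (show TangentSpace (IT E) (x : Cotangent E M) from w) ∈ levelTangent x) :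
    symplecticForm E V w = 0 :=
  (mem_levelTangent_iff_mem_orthogonal hreg x w).1 hw V hV

/-- The reduced symplectic form exists: the kernel of `ω` on `T_x M_ξ = (T_x Or(G))ᗮ` is
`T_x Or(G) ∩ T_x M_ξ = T_x Or(G_ξ)`. -/
theorem exists_isReducedForm [FiniteDimensional ℝ E] [FiniteDimensional ℝ EG]
    [ContMDiffSMul 𝓘(ℝ, EG) 𝓘(ℝ, E) ∞ G M] (hreg : IsRegularMomentum E M ξ)
    (x : levelSet E M ξ) : ∃ B, IsReducedForm x B := by
  have hN : ∀ n : levelTangent x, n ∈ (isotropyOrbitTangent x).submoduleOf (levelTangent x) ↔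
      ∀ w : levelTangent x, (show LinearMap.BilinForm ℝ (TangentSpace (IT E) (x : Cotangent E M))
        from symplecticForm E) n w = 0 := by
    intro n
    have hn := (mem_levelTangent_iff_mem_orthogonal hreg x n.1).1 n.2
    have h0 := (mem_levelTangent_iff hreg x n.1).1 n.2
    refine Iff.trans (mem_isotropyOrbitTangent_iff x n.1) ?_
    constructor
    · rintro ⟨⟨a, ha⟩, -⟩ w
      have h1 := (mem_levelTangent_iff_mem_orthogonal hreg x w.1).1 w.2 _ ⟨a, rfl⟩
      exact (congrArg (fun v => symplecticForm E v (w : TangentSpace (IT E) (x : Cotangent E M)))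
        ha).symm.trans h1
    · intro h
      refine ⟨?_, h0⟩
      have h2 : (show E × (E →L[ℝ] ℝ) from (n : TangentSpace (IT E) (x : Cotangent E M))) ∈
          LinearMap.range (generatorMap EG G (x : Cotangent E M)).toLinearMap := by
        rw [← LinearMap.BilinForm.orthogonal_orthogonal nondegenerate_symplecticForm
          isRefl_symplecticForm (LinearMap.range
            (generatorMap EG G (x : Cotangent E M)).toLinearMap)]
        intro w hw
        exact isRefl_symplecticForm _ _
          (h ⟨w, (mem_levelTangent_iff_mem_orthogonal hreg x w).2 hw⟩)
      exact h2
  obtain ⟨B, hB, hnd⟩ := exists_nondegenerate_bilinForm_quotient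
    (V := TangentSpace (IT E) (x : Cotangent E M))
    (S := show LinearMap.BilinForm ℝ (TangentSpace (IT E) (x : Cotangent E M)) from
      symplecticForm E) isRefl_symplecticForm hN
  exact ⟨B, fun η₁ η₂ => (hB η₁ η₂).trans (omega_eq (x : Cotangent E M) _ _).symm, hnd⟩

/-- The derivative of a function on the reduced space along a curve in the level set can be computed
with any extension. -/
theorem IsExtension.hasDerivAt [ContMDiffSMul 𝓘(ℝ, EG) 𝓘(ℝ, E) ∞ G M]
    {f : ReducedSpace E M ξ → ℝ} {U : Set (Cotangent E M)}
    {F : Cotangent E M → ℝ} (hF : IsExtension f U F) {x : levelSet E M ξ}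
    (hx : (x : Cotangent E M) ∈ U) {γ : ℝ → Cotangent E M} {w : E × (E →L[ℝ] ℝ)}
    (hγ : IsCurveIn (IT E) (levelSet E M ξ) (x : Cotangent E M) γ w) :
    HasDerivAt (fun t => f (reduce ⟨γ t, hγ.mem t⟩)) (differential F (x : Cotangent E M) w) 0 := by
  have h1 : MDifferentiableAt (IT E) 𝓘(ℝ, ℝ) F (x : Cotangent E M) :=
    (hF.smooth.contMDiffAt (hF.isOpen.mem_nhds hx)).mdifferentiableAt (by simp)
  refine (hγ.hasDerivAt_comp h1).congr_of_eventuallyEq ?_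
  have h2 : ∀ᶠ t in 𝓝 (0 : ℝ), γ t ∈ U :=
    hγ.smooth.continuousAt (by rw [hγ.init]; exact hF.isOpen.mem_nhds hx)
  filter_upwards [h2] with t ht
  exact (hF.eq ⟨γ t, hγ.mem t⟩ ht).symm

/-- An extension of a function on the reduced space is stationary along the orbit of the isotropy
group. -/
theorem IsExtension.differential_eq_zero [FiniteDimensional ℝ EG]
    [ContMDiffSMul 𝓘(ℝ, EG) 𝓘(ℝ, E) ∞ G M]
    {f : ReducedSpace E M ξ → ℝ} {U : Set (Cotangent E M)}
    {F : Cotangent E M → ℝ} (hF : IsExtension f U F) {x : levelSet E M ξ}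
    (hx : (x : Cotangent E M) ∈ U) {a : EG}
    (ha : momentumDeriv E M EG G (x : Cotangent E M)
      (generatorMap EG G (x : Cotangent E M) a) = 0) :
    differential F (x : Cotangent E M) (generatorMap EG G (x : Cotangent E M) a) = 0 := by
  obtain ⟨γ, hγ⟩ := exists_isCurveIn_isotropy x ha
  have h1 : IsCurveIn (IT E) (levelSet E M ξ) (lift (1 : G) (x : Cotangent E M))
      (fun t => lift (γ t) (x : Cotangent E M)) (generatorMap EG G (x : Cotangent E M) a) :=
    hγ.map (f := fun g : G => lift g (x : Cotangent E M))
      (contMDiff_lift_right (x : Cotangent E M)).contMDiffAt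
      (fun g hg => ((⟨g, hg⟩ : isotropy ξ) • x).2)
  rw [lift_one] at h1
  have h2 : (fun t => f (reduce ⟨lift (γ t) (x : Cotangent E M), h1.mem t⟩)) =
      fun _ => f (reduce x) :=
    funext fun t => congrArg f (Quotient.sound ⟨(⟨γ t, hγ.mem t⟩ : isotropy ξ), rfl⟩)
  have h3 := hF.hasDerivAt hx h1
  rw [h2] at h3
  exact h3.unique (hasDerivAt_const _ _)

/-- `η` represents the reduced Hamiltonian vector of `f` at `x`: its product with the velocity of a
curve in the level set is minus the derivative of `f` along the curve. -/
def IsLevelHamiltonian [ContMDiffSMul 𝓘(ℝ, EG) 𝓘(ℝ, E) ∞ G M] (f : ReducedSpace E M ξ → ℝ)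
    (x : levelSet E M ξ) (η : E × (E →L[ℝ] ℝ)) : Prop :=
  ∀ (γ : ℝ → Cotangent E M) (w : E × (E →L[ℝ] ℝ))
    (hγ : IsCurveIn (IT E) (levelSet E M ξ) (x : Cotangent E M) γ w),
    symplecticForm E η w = -deriv (fun t => f (reduce ⟨γ t, hγ.mem t⟩)) 0

theorem isReducedHamiltonianVector_iff [ContMDiffSMul 𝓘(ℝ, EG) 𝓘(ℝ, E) ∞ G M]
    {f : ReducedSpace E M ξ → ℝ} {x : levelSet E M ξ}
    {B : LinearMap.BilinForm ℝ (ReducedTangent x)} (hB : IsReducedForm x B) (η : levelTangent x) :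
    IsReducedHamiltonianVector x B f (reduceTangent x η) ↔ IsLevelHamiltonian f x η.1 := by
  constructor
  · intro h γ w hγ
    refine Eq.trans ?_ (h γ ⟨w, Submodule.subset_span ⟨γ, hγ⟩⟩ hγ)
    exact ((hB.pullback η ⟨w, Submodule.subset_span ⟨γ, hγ⟩⟩).trans
      (omega_eq (x : Cotangent E M) _ _)).symm
  · intro h γ w hγ
    refine Eq.trans ?_ (h γ w.1 hγ)
    exact (hB.pullback _ _).trans (omega_eq (x : Cotangent E M) _ _)

/-- The value of the reduced bracket is determined by the representatives of the reduced Hamiltonian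
vectors. -/
theorem isReducedBracket_iff [FiniteDimensional ℝ E] [FiniteDimensional ℝ EG]
    [ContMDiffSMul 𝓘(ℝ, EG) 𝓘(ℝ, E) ∞ G M] (hreg : IsRegularMomentum E M ξ)
    {f₁ f₂ h : ReducedSpace E M ξ → ℝ} :
    IsReducedBracket f₁ f₂ h ↔ ∀ x : levelSet E M ξ, ∃ η₁ η₂ : levelTangent x,
      IsLevelHamiltonian f₁ x η₁.1 ∧ IsLevelHamiltonian f₂ x η₂.1 ∧
        h (reduce x) = symplecticForm E η₁.1 η₂.1 := by
  constructor
  · intro hh x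
    obtain ⟨B, K₁, K₂, hB, h1, h2, h3⟩ := hh x
    obtain ⟨η₁, rfl⟩ := Submodule.mkQ_surjective _ K₁
    obtain ⟨η₂, rfl⟩ := Submodule.mkQ_surjective _ K₂
    exact ⟨η₁, η₂, (isReducedHamiltonianVector_iff hB η₁).1 h1,
      (isReducedHamiltonianVector_iff hB η₂).1 h2,
      h3.trans ((hB.pullback _ _).trans (omega_eq (x : Cotangent E M) _ _))⟩
  · intro hh x
    obtain ⟨η₁, η₂, h1, h2, h3⟩ := hh x
    obtain ⟨B, hB⟩ := exists_isReducedForm hreg x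
    exact ⟨B, reduceTangent x η₁, reduceTangent x η₂, hB,
      (isReducedHamiltonianVector_iff hB η₁).2 h1, (isReducedHamiltonianVector_iff hB η₂).2 h2,
      h3.trans ((hB.pullback _ _).trans (omega_eq (x : Cotangent E M) _ _)).symm⟩

/-- Representatives of the same reduced Hamiltonian vectors, tangent to the level set, have the same
symplectic product. -/
theorem IsLevelHamiltonian.symplecticForm_eq [FiniteDimensional ℝ EG]
    [ContMDiffSMul 𝓘(ℝ, EG) 𝓘(ℝ, E) ∞ G M] (hreg : IsRegularMomentum E M ξ)
    {f₁ f₂ : ReducedSpace E M ξ → ℝ} {x : levelSet E M ξ} {η₁ η₂ ζ₁ ζ₂ : E × (E →L[ℝ] ℝ)}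
    (h₁ : IsLevelHamiltonian f₁ x η₁) (h₂ : IsLevelHamiltonian f₂ x η₂)
    (k₁ : IsLevelHamiltonian f₁ x ζ₁) (k₂ : IsLevelHamiltonian f₂ x ζ₂)
    (hη : (show TangentSpace (IT E) (x : Cotangent E M) from η₂) ∈ levelTangent x)
    (hζ : (show TangentSpace (IT E) (x : Cotangent E M) from ζ₁) ∈ levelTangent x) :
    symplecticForm E η₁ η₂ = symplecticForm E ζ₁ ζ₂ := by
  obtain ⟨γ, hγ⟩ := exists_isCurveIn_level hreg x ((mem_levelTangent_iff hreg x η₂).1 hη)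
  obtain ⟨δ, hδ⟩ := exists_isCurveIn_level hreg x ((mem_levelTangent_iff hreg x ζ₁).1 hζ)
  -- Replace the first factor against the tangent vector `η₂`, then the second against `ζ₁`.
  have e1 : symplecticForm E η₁ η₂ = symplecticForm E ζ₁ η₂ :=
    (h₁ γ η₂ hγ).trans (k₁ γ η₂ hγ).symm
  have e2 : symplecticForm E η₂ ζ₁ = symplecticForm E ζ₂ ζ₁ :=
    (h₂ δ ζ₁ hδ).trans (k₂ δ ζ₁ hδ).symm
  rw [e1, symplecticForm_swap η₂, e2, ← symplecticForm_swap]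

/-- The tangent map of the lift of `g`, between the model spaces. -/
noncomputable def liftDeriv {E M G : Type*} [NormedAddCommGroup E] [NormedSpace ℝ E]
    [TopologicalSpace M] [ChartedSpace E M] [IsManifold 𝓘(ℝ, E) ∞ M] [Group G] [MulAction G M]
    (g : G) (p : Cotangent E M) : (E × (E →L[ℝ] ℝ)) →L[ℝ] E × (E →L[ℝ] ℝ) :=
  mfderiv (IT E) (IT E) (fun q : Cotangent E M => lift g q) p

theorem IsCurveIn.lift [ContMDiffSMul 𝓘(ℝ, EG) 𝓘(ℝ, E) ∞ G M] {x : levelSet E M ξ}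
    {γ : ℝ → Cotangent E M} {w : E × (E →L[ℝ] ℝ)}
    (hγ : IsCurveIn (IT E) (levelSet E M ξ) (x : Cotangent E M) γ w) (g : isotropy ξ) :
    IsCurveIn (IT E) (levelSet E M ξ) ((g • x : levelSet E M ξ) : Cotangent E M)
      (fun t => SymplecticReduction.lift (g : G) (γ t))
      (liftDeriv (g : G) (x : Cotangent E M) w) :=
  hγ.map (contMDiff_lift_left (EG := EG) (g : G)).contMDiffAt
    (fun y hy => (g • (⟨y, hy⟩ : levelSet E M ξ)).2)

theorem reduce_smul [ContMDiffSMul 𝓘(ℝ, EG) 𝓘(ℝ, E) ∞ G M] (g : isotropy ξ) (x : levelSet E M ξ) :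
    reduce (g • x) = reduce x :=
  Quotient.sound ⟨g, rfl⟩

/-- The representatives of the reduced Hamiltonian vectors are carried along by the action of the
isotropy group, which preserves `ω` and the level set. -/
theorem IsLevelHamiltonian.lift [ContMDiffSMul 𝓘(ℝ, EG) 𝓘(ℝ, E) ∞ G M]
    {f : ReducedSpace E M ξ → ℝ} {x : levelSet E M ξ} {η : E × (E →L[ℝ] ℝ)}
    (h : IsLevelHamiltonian f x η) (g : isotropy ξ) :
    IsLevelHamiltonian f (g • x) (liftDeriv (g : G) (x : Cotangent E M) η) := by
  intro γ w hγ
  -- The curve at `g • x` is the image under `g` of the curve `g⁻¹ • γ` at `x`.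
  have h1 := hγ.lift g⁻¹
  obtain ⟨w', hw'⟩ : ∃ w', w' = liftDeriv ((g⁻¹ : isotropy ξ) : G)
    ((g • x : levelSet E M ξ) : Cotangent E M) w := ⟨_, rfl⟩
  rw [← hw', inv_smul_smul] at h1
  have h2 := h1.lift g
  have h3 : (fun t => SymplecticReduction.lift (g : G)
      (SymplecticReduction.lift ((g⁻¹ : isotropy ξ) : G) (γ t))) = γ := by
    funext t
    exact congrArg Subtype.val (smul_inv_smul g (⟨γ t, hγ.mem t⟩ : levelSet E M ξ))
  rw [h3] at h2
  have h4 : liftDeriv (g : G) (x : Cotangent E M) w' = w := h2.velocity.symm.trans hγ.velocity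
  have h5 : symplecticForm E (liftDeriv (g : G) (x : Cotangent E M) η)
      (liftDeriv (g : G) (x : Cotangent E M) w') = symplecticForm E η w' :=
    (omega_eq (SymplecticReduction.lift (g : G) (x : Cotangent E M)) _ _).symm.trans
      ((omega_lift (EG := EG) (g : G) (x : Cotangent E M) η w').trans
        (omega_eq (x : Cotangent E M) _ _))
  rw [h4] at h5
  rw [h5, h _ _ h1]
  congr 2
  funext t
  exact congrArg f (reduce_smul g⁻¹ (⟨γ t, hγ.mem t⟩ : levelSet E M ξ))

end Reduction

/-! ### The reduced bracket -/

section Bracket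

variable {E : Type*} [NormedAddCommGroup E] [NormedSpace ℝ E] [FiniteDimensional ℝ E]
  {M : Type*} [TopologicalSpace M] [ChartedSpace E M] [IsManifold 𝓘(ℝ, E) ∞ M]
  {EG : Type*} [NormedAddCommGroup EG] [NormedSpace ℝ EG] [FiniteDimensional ℝ EG]
  {G : Type*} [TopologicalSpace G] [ChartedSpace EG G] [Group G] [LieGroup 𝓘(ℝ, EG) ∞ G]
  [MulAction G M] [ContMDiffSMul 𝓘(ℝ, EG) 𝓘(ℝ, E) ∞ G M]
  {ξ : GroupLieAlgebra 𝓘(ℝ, EG) G →L[ℝ] ℝ}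

/-- The correction vector exists because `K_F` is orthogonal to `T_x Or(G) ∩ T_x M_ξ`, on which `dF`
vanishes. -/
theorem IsExtension.exists_isCorrection (hreg : IsRegularMomentum E M ξ)
    {f : ReducedSpace E M ξ → ℝ} {U : Set (Cotangent E M)} {F : Cotangent E M → ℝ}
    (hF : IsExtension f U F) {x : levelSet E M ξ} (hx : (x : Cotangent E M) ∈ U) :
    ∃ V, IsCorrection F x V := by
  obtain ⟨V, hV, hKV⟩ := exists_add_mem_orthogonal nondegenerate_symplecticForm
    isRefl_symplecticForm (LinearMap.range (generatorMap EG G (x : Cotangent E M)).toLinearMap)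
    (k := (show E × (E →L[ℝ] ℝ) from hamiltonianField F (x : Cotangent E M))) (by
      rintro _ ⟨a, rfl⟩ ha
      have h1 := (mem_levelTangent_iff hreg x _).1
        ((mem_levelTangent_iff_mem_orthogonal hreg x _).2 ha)
      refine (symplecticForm_swap _ _).trans (neg_eq_zero.2 ?_)
      refine (symplecticForm_hamiltonianField F (x : Cotangent E M) _).trans (neg_eq_zero.2 ?_)
      exact hF.differential_eq_zero hx h1)
  exact ⟨V, hV, (mem_levelTangent_iff_mem_orthogonal hreg x _).2 hKV⟩

/-- The corrected Hamiltonian vector `K_F + V` represents the reduced Hamiltonian vector. -/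
theorem IsCorrection.isLevelHamiltonian (hreg : IsRegularMomentum E M ξ)
    {f : ReducedSpace E M ξ → ℝ} {U : Set (Cotangent E M)} {F : Cotangent E M → ℝ}
    (hF : IsExtension f U F) {x : levelSet E M ξ} (hx : (x : Cotangent E M) ∈ U)
    {V : E × (E →L[ℝ] ℝ)} (hV : IsCorrection F x V) :
    IsLevelHamiltonian f x
      ((show E × (E →L[ℝ] ℝ) from hamiltonianField F (x : Cotangent E M)) + V) := by
  intro γ w hγ
  have h1 := symplecticForm_orbit_level_eq_zero hreg hV.tangent_orbit
    (Submodule.subset_span ⟨γ, hγ⟩ : _ ∈ levelTangent x)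
  have h2 := symplecticForm_hamiltonianField F (x : Cotangent E M) w
  rw [(hF.hasDerivAt hx hγ).deriv]
  refine (LinearMap.map_add₂ (symplecticForm E) _ _ _).trans ?_
  rw [h1, add_zero]
  exact h2

/-- The reduced bracket exists: the product of the representatives of the reduced Hamiltonian
vectors is constant on the orbits of the isotropy group. -/
theorem exists_isReducedBracket (hreg : IsRegularMomentum E M ξ) {f₁ f₂ : ReducedSpace E M ξ → ℝ}
    {U : Set (Cotangent E M)} {F₁ F₂ : Cotangent E M → ℝ} (hU : levelSet E M ξ ⊆ U)
    (h₁ : IsExtension f₁ U F₁) (h₂ : IsExtension f₂ U F₂) : ∃ h, IsReducedBracket f₁ f₂ h := by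
  have hη : ∀ x : levelSet E M ξ, ∃ η : levelTangent x × levelTangent x,
      IsLevelHamiltonian f₁ x η.1.1 ∧ IsLevelHamiltonian f₂ x η.2.1 := by
    intro x
    obtain ⟨V₁, hV₁⟩ := h₁.exists_isCorrection hreg (hU x.2)
    obtain ⟨V₂, hV₂⟩ := h₂.exists_isCorrection hreg (hU x.2)
    exact ⟨⟨⟨_, hV₁.tangent_level⟩, ⟨_, hV₂.tangent_level⟩⟩,
      hV₁.isLevelHamiltonian hreg h₁ (hU x.2), hV₂.isLevelHamiltonian hreg h₂ (hU x.2)⟩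
  choose η hη₁ hη₂ using hη
  have hinv : ∀ x y : levelSet E M ξ, MulAction.orbitRel (isotropy ξ) (levelSet E M ξ) x y →
      symplecticForm E (η x).1.1 (η x).2.1 = symplecticForm E (η y).1.1 (η y).2.1 := by
    rintro _ y ⟨g, rfl⟩
    obtain ⟨γ, hγ⟩ := exists_isCurveIn_level hreg y
      ((mem_levelTangent_iff hreg y _).1 (η y).2.2)
    have h3 : symplecticForm E (liftDeriv (g : G) (y : Cotangent E M) (η y).1.1)
        (liftDeriv (g : G) (y : Cotangent E M) (η y).2.1) =
          symplecticForm E (η y).1.1 (η y).2.1 :=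
      (omega_eq (lift (g : G) (y : Cotangent E M)) _ _).symm.trans
        ((omega_lift (EG := EG) (g : G) (y : Cotangent E M) (η y).1.1 (η y).2.1).trans
          (omega_eq (y : Cotangent E M) _ _))
    -- The images of the representatives at `y` represent the reduced vectors at `g • y`.
    rw [← h3]
    exact ((hη₁ y).lift g).symplecticForm_eq hreg ((hη₂ y).lift g) (hη₁ (g • y)) (hη₂ (g • y))
      (Submodule.subset_span ⟨_, hγ.lift g⟩) (η (g • y)).1.2 |>.symm
  refine ⟨Quotient.lift (fun x => symplecticForm E (η x).1.1 (η x).2.1) hinv, ?_⟩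
  exact (isReducedBracket_iff hreg).2 fun x => ⟨(η x).1, (η x).2, hη₁ x, hη₂ x, rfl⟩

theorem IsReducedBracket.eq_symplecticForm (hreg : IsRegularMomentum E M ξ)
    {f₁ f₂ h : ReducedSpace E M ξ → ℝ} (hh : IsReducedBracket f₁ f₂ h) {x : levelSet E M ξ}
    {η₁ η₂ : E × (E →L[ℝ] ℝ)} (h₁ : IsLevelHamiltonian f₁ x η₁) (h₂ : IsLevelHamiltonian f₂ x η₂)
    (hη₂ : (show TangentSpace (IT E) (x : Cotangent E M) from η₂) ∈ levelTangent x) :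
    h (reduce x) = symplecticForm E η₁ η₂ := by
  obtain ⟨ζ₁, ζ₂, k₁, k₂, h3⟩ := (isReducedBracket_iff hreg).1 hh x
  exact h3.trans (h₁.symplecticForm_eq hreg h₂ k₁ k₂ hη₂ ζ₁.2).symm

theorem IsReducedBracket.unique (hreg : IsRegularMomentum E M ξ)
    {f₁ f₂ h h' : ReducedSpace E M ξ → ℝ} (hh : IsReducedBracket f₁ f₂ h)
    (hh' : IsReducedBracket f₁ f₂ h') : h = h' := by
  funext y
  obtain ⟨x, rfl⟩ := Quotient.exists_rep y
  obtain ⟨η₁, η₂, h₁, h₂, h3⟩ := (isReducedBracket_iff hreg).1 hh x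
  exact h3.trans (hh'.eq_symplecticForm hreg h₁ h₂ η₂.2).symm

theorem IsReducedBracket.eq_poisson_add (hreg : IsRegularMomentum E M ξ)
    {f₁ f₂ h : ReducedSpace E M ξ → ℝ} (hh : IsReducedBracket f₁ f₂ h)
    {U : Set (Cotangent E M)} {F₁ F₂ : Cotangent E M → ℝ}
    (h₁ : IsExtension f₁ U F₁) (h₂ : IsExtension f₂ U F₂) {x : levelSet E M ξ}
    (hx : (x : Cotangent E M) ∈ U) {V₁ V₂ : E × (E →L[ℝ] ℝ)} (hV₁ : IsCorrection F₁ x V₁)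
    (hV₂ : IsCorrection F₂ x V₂) :
    h (reduce x) = poisson F₁ F₂ (x : Cotangent E M) +
      1 / 2 * (differential F₂ (x : Cotangent E M) V₁ -
        differential F₁ (x : Cotangent E M) V₂) := by
  refine (hh.eq_symplecticForm hreg (hV₁.isLevelHamiltonian hreg h₁ hx)
    (hV₂.isLevelHamiltonian hreg h₂ hx) hV₂.tangent_level).trans ?_
  refine (symplecticForm_add_add_eq
    (symplecticForm_orbit_level_eq_zero hreg hV₁.tangent_orbit hV₂.tangent_level)
    (symplecticForm_orbit_level_eq_zero hreg hV₂.tangent_orbit hV₁.tangent_level)).trans ?_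
  have e1 := symplecticForm_hamiltonianField F₁ (x : Cotangent E M) V₂
  have e2 := symplecticForm_hamiltonianField F₂ (x : Cotangent E M) V₁
  have e3 : poisson F₁ F₂ (x : Cotangent E M) = symplecticForm E
    (show E × (E →L[ℝ] ℝ) from hamiltonianField F₁ (x : Cotangent E M))
    (show E × (E →L[ℝ] ℝ) from hamiltonianField F₂ (x : Cotangent E M)) := omega_eq _ _ _
  rw [e3]
  refine congrArg₂ (fun a b : ℝ => _ + 1 / 2 * (a - b)) e1 e2 |>.trans ?_
  ring

end Bracket

end SymplecticReduction

theorem mainTheorem6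
    {E : Type*} [NormedAddCommGroup E] [NormedSpace ℝ E] [FiniteDimensional ℝ E]
    {M : Type*} [TopologicalSpace M] [T2Space M] [SecondCountableTopology M]
    [ChartedSpace E M] [IsManifold 𝓘(ℝ, E) ∞ M]
    {EG : Type*} [NormedAddCommGroup EG] [NormedSpace ℝ EG] [FiniteDimensional ℝ EG]
    {G : Type*} [TopologicalSpace G] [ChartedSpace EG G] [Group G] [LieGroup 𝓘(ℝ, EG) ∞ G]
    [MulAction G M] [ContMDiffSMul 𝓘(ℝ, EG) 𝓘(ℝ, E) ∞ G M]
    (ξ : GroupLieAlgebra 𝓘(ℝ, EG) G →L[ℝ] ℝ)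
    (hreg : IsRegularMomentum E M ξ)
    (hfree : ∀ (g : isotropy ξ) (x : levelSet E M ξ), g • x = x → g = 1)
    (hproper : ProperSMul (isotropy ξ) (levelSet E M ξ))
    (f₁ f₂ : ReducedSpace E M ξ → ℝ) (hf₁ : IsSmoothReduced f₁) (hf₂ : IsSmoothReduced f₂) :
    (∀ (F : Cotangent E M → ℝ) (p : Cotangent E M), ∃! K, IsHamiltonianVector F p K) ∧
    (∃! h : ReducedSpace E M ξ → ℝ, IsReducedBracket f₁ f₂ h) ∧
    (∃ (U : Set (Cotangent E M)) (F₁ F₂ : Cotangent E M → ℝ),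
      levelSet E M ξ ⊆ U ∧ IsExtension f₁ U F₁ ∧ IsExtension f₂ U F₂) ∧
    (∀ h : ReducedSpace E M ξ → ℝ, IsReducedBracket f₁ f₂ h →
      ∀ (U : Set (Cotangent E M)) (F₁ F₂ : Cotangent E M → ℝ),
        levelSet E M ξ ⊆ U → IsExtension f₁ U F₁ → IsExtension f₂ U F₂ →
        ∀ x : levelSet E M ξ,
          (∃ V₁, IsCorrection F₁ x V₁) ∧ (∃ V₂, IsCorrection F₂ x V₂) ∧
          ∀ V₁ V₂, IsCorrection F₁ x V₁ → IsCorrection F₂ x V₂ →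
            h (reduce x) = poisson F₁ F₂ (x : Cotangent E M) +
              1 / 2 * (dirDeriv F₂ (x : Cotangent E M) V₁ -
                dirDeriv F₁ (x : Cotangent E M) V₂)) := by
  obtain ⟨F₁, hF₁⟩ := exists_isExtension_univ hf₁
  obtain ⟨F₂, hF₂⟩ := exists_isExtension_univ hf₂
  refine ⟨existsUnique_isHamiltonianVector, ?_,
    ⟨Set.univ, F₁, F₂, Set.subset_univ _, hF₁, hF₂⟩, ?_⟩
  · obtain ⟨h, hh⟩ := exists_isReducedBracket hreg (Set.subset_univ _) hF₁ hF₂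
    exact ⟨h, hh, fun h' hh' => IsReducedBracket.unique hreg hh' hh⟩
  · intro h hh U F₁ F₂ hU h₁ h₂ x
    exact ⟨h₁.exists_isCorrection hreg (hU x.2), h₂.exists_isCorrection hreg (hU x.2),
      fun V₁ V₂ hV₁ hV₂ => hh.eq_poisson_add hreg h₁ h₂ (hU x.2) hV₁ hV₂⟩
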